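/- Let $K$ be an infinite perfect field (for instance any field of characteristic $0$) with algebraic closure $\overline K$, and let $f\in K(z)$ be a rational function of degree $3$, viewed as a self-map of $\mathbb P^1(\overline K)$. For $\rho\in\mathrm{PGL}_2(\overline K)$ put $f^\rho=\rho^{-1}\circ f\circ\rho$, and let $\mathrm{Aut}(f)=\{\rho\in \mathrm{PGL}_2(\overline K): f^\rho=f\}$. The multiplier of a fixed point $x$ of $f$ is $f'(x)$ (computed after a change of coordinate if $x=\infty$). A map $g$ of degree $3$ is in fixed-point multiplier form if it has at least three distinct fixed points and every fixed point equals its multiplier. It is in partial fixed-point multiplier form if it has at most two fixed points and all of them equal their multipliers, or it has four fixed points and at least three of them equal their multipliers, or it is in fixed-point multiplier form. The first dynatomic field $L$ of $f$ is the extension of $K$ generated by the fixed points of $f$, and $\mathrm{Gal}(L/K)$ is the first dynatomic Galois group. Assume that $\mathrm{Aut}(f)$ is trivial. Then for every $\rho\in\mathrm{PGL}_2(\overline K)$ such that $f^\rho$ is in partial fixed-point multiplier form, $f^\rho$ is defined over $K$ if and only if $\rho$ is defined over $K$, that is, $\rho\in\mathrm{PGL}_2(K)$. Let $S$ be the set of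 all $\rho\in\mathrm{PGL}_2(\overline K)$ such that $f^\rho$ is in partial fixed-point multiplier form and defined over $K$, and suppose that $S\neq\emptyset$. Then: 1. $\#S=1$ if and only if $f^\rho$ is in fixed-point multiplier form for some $\rho\in S$, or $\mathrm{Gal}(L/K)\cong S_3$, or $\mathrm{Gal}(L/K)\cong\mathbb Z/3\mathbb Z$. 2. $\#S=2$ if and only if no $f^\rho$ with $\rho\in S$ is in fixed-point multiplier form, $f$ has four fixed points, and either $\mathrm{Gal}(L/K)$ has order $2$ or $f$ has two distinct fixed points with the same multiplier. 3. $\#S=4$ if and only if no $f^\rho$ with $\rho\in S$ is in fixed-point multiplier form, $f$ has four fixed points with pairwise distinct multipliers, and $\mathrm{Gal}(L/K)$ is trivial. Moreover, if $f$ has at least three distinct fixed points, then $\#S\in\{1,2,4\}$. -/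

import Mathlib

open scoped MatrixGroups Polynomial

namespace RatDyn

noncomputable section

/-- Degree of a rational function `p / q` in lowest terms, `max (deg p) (deg q)`. -/
def degree {F : Type*} [Field F] (f : RatFunc F) : ℕ :=
  max f.num.natDegree f.denom.natDegree

open scoped Classical in
/-- The self-map of `ℙ¹(F) = F ∪ {∞}` induced by a rational function. -/
def evalP1 {F : Type*} [Field F] (f : RatFunc F) : OnePoint F → OnePoint F
  | some z =>
      if f.denom.eval z = 0 then OnePoint.infty
      else ((f.num.eval z / f.denom.eval z : F) : OnePoint F)
  | OnePoint.infty =>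
      if f.denom.natDegree < f.num.natDegree then OnePoint.infty
      else ((f.num.coeff f.denom.natDegree / f.denom.leadingCoeff : F) : OnePoint F)

/-- The composition `f ∘ g` (meaningful when `g` is not constant). -/
def comp {F : Type*} [Field F] (f g : RatFunc F) : RatFunc F :=
  RatFunc.eval RatFunc.C g f

/-- The Möbius transformation `(a X + b) / (c X + d)` of an invertible matrix. -/
def mobius {F : Type*} [Field F] (g : GL (Fin 2) F) : RatFunc F :=
  (RatFunc.C (g.val 0 0) * RatFunc.X + RatFunc.C (g.val 0 1)) /
    (RatFunc.C (g.val 1 0) * RatFunc.X + RatFunc.C (g.val 1 1))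

theorem mobius_mul_scalar {F : Type*} [Field F] (g : GL (Fin 2) F) (u : Fˣ) :
    mobius (g * Matrix.GeneralLinearGroup.scalar (Fin 2) u) = mobius g := by
  have hu : (RatFunc.C (u : F) : RatFunc F) ≠ 0 := by simp
  have h : ∀ i j, (g * Matrix.GeneralLinearGroup.scalar (Fin 2) u).val i j
      = (u : F) * g.val i j := by
    intro i j
    simp [mul_comm]
  unfold mobius
  simp only [h, map_mul]
  rw [mul_assoc, mul_assoc, ← mul_add, ← mul_add, mul_div_mul_left _ _ hu]

/-- `g⁻¹ ∘ f ∘ g` for an invertible matrix `g`. -/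
def conjGL {F : Type*} [Field F] (f : RatFunc F) (g : GL (Fin 2) F) : RatFunc F :=
  comp (mobius g⁻¹) (comp f (mobius g))

/-- The conjugate `f^ρ = ρ⁻¹ ∘ f ∘ ρ` for `ρ ∈ PGL₂(F)`. -/
def conj {F : Type*} [Field F] (f : RatFunc F) (ρ : PGL(2, F)) : RatFunc F :=
  Quotient.lift (conjGL f) (by
    intro g h hgh
    have e : (Matrix.ProjGenLinGroup.mk g : PGL(2, F)) = Matrix.ProjGenLinGroup.mk h :=
      Quotient.sound hgh
    obtain ⟨u, rfl⟩ := Matrix.ProjGenLinGroup.mk_eq_mk_iff.mp e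
    have hinv : (g * Matrix.GeneralLinearGroup.scalar (Fin 2) u)⁻¹
        = g⁻¹ * Matrix.GeneralLinearGroup.scalar (Fin 2) u⁻¹ := by
      have hc : Matrix.GeneralLinearGroup.scalar (Fin 2) u⁻¹ ∈
          Subgroup.center (GL (Fin 2) F) := by
        rw [Matrix.GeneralLinearGroup.center_eq_range_scalar]
        exact ⟨_, rfl⟩
      rw [mul_inv_rev, ← map_inv]
      exact (Subgroup.mem_center_iff.mp hc g⁻¹).symm
    unfold conjGL
    rw [hinv, mobius_mul_scalar, mobius_mul_scalar]) ρ

theorem conj_mk {F : Type*} [Field F] (f : RatFunc F) (g : GL (Fin 2) F) :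
    conj f (Matrix.ProjGenLinGroup.mk g) = conjGL f g := rfl

/-- The automorphism group of `f`, as a subset of `PGL₂(F)`. -/
def aut {F : Type*} [Field F] (f : RatFunc F) : Set PGL(2, F) :=
  {ρ | conj f ρ = f}

/-- The fixed points of `f` in `ℙ¹(F)`. -/
def fixedPts {F : Type*} [Field F] (f : RatFunc F) : Set (OnePoint F) :=
  {P | evalP1 f P = P}

/-- The derivative `f'(z)` at a finite point `z` that is not a pole. -/
def derivAt {F : Type*} [Field F] (f : RatFunc F) (z : F) : F :=
  (f.num.derivative.eval z * f.denom.eval z - f.num.eval z * f.denom.derivative.eval z) /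
    f.denom.eval z ^ 2

/-- The multiplier of `f` at a fixed point: `f'(z)` at a finite point `z`, and at `∞` the
derivative at `0` of `1 / f(1 / w)`. (Only used at fixed points.) -/
def multiplier {F : Type*} [Field F] (f : RatFunc F) : OnePoint F → F
  | some z => derivAt f z
  | OnePoint.infty => derivAt (comp f RatFunc.X⁻¹)⁻¹ 0

/-- The fixed points that are equal to their own multiplier. -/
def matchedPts {F : Type*} [Field F] (f : RatFunc F) : Set (OnePoint F) :=
  {P ∈ fixedPts f | P = ((multiplier f P : F) : OnePoint F)}

/-- Fixed-point multiplier form: at least three distinct fixed points, and every fixed point is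
equal to its multiplier. -/
def IsFPMForm {F : Type*} [Field F] (f : RatFunc F) : Prop :=
  3 ≤ (fixedPts f).encard ∧ fixedPts f ⊆ matchedPts f

/-- Partial fixed-point multiplier form of a cubic rational map: at most two fixed points, all
equal to their multipliers; or four fixed points, at least three of them equal to their
multipliers; or (needed for exactly three fixed points) fixed-point multiplier form. -/
def IsPartialFPMForm {F : Type*} [Field F] (f : RatFunc F) : Prop :=
  ((fixedPts f).encard ≤ 2 ∧ fixedPts f ⊆ matchedPts f) ∨
  ((fixedPts f).encard = 4 ∧ 3 ≤ (matchedPts f).encard) ∨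
  IsFPMForm f

/-- `f` is a quotient of polynomials with coefficients in `K`. -/
def IsDefinedOver (K : Type*) {F : Type*} [Field K] [Field F] [Algebra K F]
    (f : RatFunc F) : Prop :=
  ∃ p q : K[X], q ≠ 0 ∧
    f = algebraMap F[X] (RatFunc F) (p.map (algebraMap K F)) /
      algebraMap F[X] (RatFunc F) (q.map (algebraMap K F))

/-- `ρ` lies in the image of `PGL₂(K)` in `PGL₂(F)`. -/
def IsDefinedOverPGL (K : Type*) {F : Type*} [Field K] [Field F] [Algebra K F]
    (ρ : PGL(2, F)) : Prop :=
  ρ ∈ (Matrix.ProjGenLinGroup.map (n := Fin 2) (algebraMap K F)).range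

/-- The `ρ ∈ PGL₂(F)` for which `f^ρ` is in partial fixed-point multiplier form and defined
over `K`. -/
def partialConjugators (K : Type*) {F : Type*} [Field K] [Field F] [Algebra K F]
    (f : RatFunc F) : Set PGL(2, F) :=
  {ρ | IsPartialFPMForm (conj f ρ) ∧ IsDefinedOver K (conj f ρ)}

/-- The first dynatomic field: the extension of `K` generated by the (finite) fixed points. -/
def dynatomicField (K : Type*) {F : Type*} [Field K] [Field F] [Algebra K F]
    (f : RatFunc F) : IntermediateField K F :=
  IntermediateField.adjoin K {z : F | (z : OnePoint F) ∈ fixedPts f}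

/-- The first dynatomic Galois group. -/
abbrev DynatomicGal (K : Type*) {F : Type*} [Field K] [Field F] [Algebra K F]
    (f : RatFunc F) : Type _ :=
  dynatomicField K f ≃ₐ[K] dynatomicField K f

/-- Two distinct fixed points of `f` have the same multiplier. -/
def HasRepeatedMultiplier {F : Type*} [Field F] (f : RatFunc F) : Prop :=
  ∃ P ∈ fixedPts f, ∃ Q ∈ fixedPts f, P ≠ Q ∧ multiplier f P = multiplier f Q

end

end RatDyn

namespace RatDyn

section Lift

open MvPolynomial (aeval eval bind₁ pderiv)

theorem _root_.MvPolynomial.IsHomogeneous.aeval_mul_left {R A σ : Type*} [CommSemiring R]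
    [CommSemiring A] [Algebra R A] {P : MvPolynomial σ R} {d : ℕ} (hP : P.IsHomogeneous d)
    (c : A) (x : σ → A) : aeval (fun i => c * x i) P = c ^ d * aeval x P := by
  rw [P.as_sum]
  simp only [map_sum, MvPolynomial.aeval_monomial, Finset.mul_sum]
  refine Finset.sum_congr rfl fun m hm => ?_
  simp only [mul_pow, Finsupp.prod, Finset.prod_mul_distrib, Finset.prod_pow_eq_pow_sum]
  rw [← hP.degree_eq_sum_deg_support hm]
  ring

/-- Substitution of `(X, 1)` in a polynomial in two variables. -/
noncomputable abbrev dehom {k : Type*} [CommSemiring k] : MvPolynomial (Fin 2) k →ₐ[k] k[X] :=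
  aeval ![Polynomial.X, 1]

variable {k : Type*} [Field k]

theorem eval_dehom (P : MvPolynomial (Fin 2) k) (z : k) :
    (dehom P).eval z = eval ![z, 1] P := by
  induction P using MvPolynomial.induction_on with
  | C a => simp [dehom]
  | add p q hp hq => simp [hp, hq]
  | mul_X p i hp =>
    rw [map_mul, Polynomial.eval_mul, hp, map_mul]
    fin_cases i <;> simp [dehom]

theorem natDegree_dehom_le {P : MvPolynomial (Fin 2) k} {d : ℕ} (hP : P.IsHomogeneous d) :
    (dehom P).natDegree ≤ d := by
  rw [P.as_sum, map_sum]
  refine Polynomial.natDegree_sum_le_of_forall_le _ _ fun m hm => ?_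
  have hd : m 0 + m 1 = d := by
    rw [hP.degree_eq_sum_deg_support hm, ← Fin.sum_univ_two]
    exact (Finset.sum_subset (Finset.subset_univ _) (by simp)).symm
  simp only [dehom, MvPolynomial.aeval_monomial]
  rw [Finsupp.prod_fintype _ _ (by simp)]
  simp only [Fin.prod_univ_two, Matrix.cons_val_zero, Matrix.cons_val_one, one_pow, mul_one]
  refine (Polynomial.natDegree_C_mul_X_pow_le _ _).trans (by omega)

theorem homogenize_dehom {P : MvPolynomial (Fin 2) k} {d : ℕ} (hP : P.IsHomogeneous d) :
    (dehom P).homogenize d = P :=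
  Polynomial.homogenize_eq_of_isHomogeneous hP rfl

theorem coeff_dehom {P : MvPolynomial (Fin 2) k} {d : ℕ} (hP : P.IsHomogeneous d) :
    (dehom P).coeff d = eval ![1, 0] P := by
  conv_rhs => rw [← homogenize_dehom hP, Polynomial.homogenize]
  simp only [map_sum, MvPolynomial.eval_monomial]
  rw [Finset.sum_eq_single (d, 0)]
  · rw [Finsupp.prod_fintype _ _ (by simp)]
    simp
  · rintro ⟨a, b⟩ hab hne
    have : b ≠ 0 := by
      rintro rfl
      simp at hab
      simp [hab] at hne
    rw [Finsupp.prod_fintype _ _ (by simp)]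
    simp [this]
  · simp

/-- `F` is a homogeneous lift of degree `d` of the rational function `f`. -/
structure IsLift (d : ℕ) (F : Fin 2 → MvPolynomial (Fin 2) k) (f : RatFunc k) : Prop where
  hom : ∀ i, (F i).IsHomogeneous d
  nz : ∀ v : Fin 2 → k, (∀ i, eval v (F i) = 0) → v = 0
  eq : f = algebraMap k[X] (RatFunc k) (dehom (F 0)) / algebraMap k[X] (RatFunc k) (dehom (F 1))

theorem IsLift.unique {d : ℕ} {F : Fin 2 → MvPolynomial (Fin 2) k} {f g : RatFunc k}
    (hf : IsLift d F f) (hg : IsLift d F g) : f = g :=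
  hf.eq.trans hg.eq.symm

variable [IsAlgClosed k]

theorem IsLift.isCoprime {d : ℕ} {F : Fin 2 → MvPolynomial (Fin 2) k} {f : RatFunc k}
    (hf : IsLift d F f) : IsCoprime (dehom (F 0)) (dehom (F 1)) := by
  rw [Polynomial.isCoprime_iff_aeval_ne_zero_of_isAlgClosed k k]
  intro z
  by_contra! h
  have := hf.nz ![z, 1] (by
    intro i
    rw [← eval_dehom]
    fin_cases i
    · simpa [Polynomial.aeval_def] using h.1
    · simpa [Polynomial.aeval_def] using h.2)
  simpa using congr_fun this 1

theorem IsLift.dehom_ne_zero {d : ℕ} (hd : d ≠ 0) {F : Fin 2 → MvPolynomial (Fin 2) k}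
    {f : RatFunc k} (hf : IsLift d F f) : dehom (F 1) ≠ 0 := by
  intro h
  have h0 := hf.isCoprime
  rw [h, isCoprime_zero_right, Polynomial.isUnit_iff] at h0
  obtain ⟨c, -, hc⟩ := h0
  have := hf.nz ![1, 0] (by
    intro i
    rw [← coeff_dehom (hf.hom i)]
    fin_cases i
    · simp [← hc, Polynomial.coeff_C, hd]
    · simp [h])
  simpa using congr_fun this 0

theorem IsLift.exists_num_denom {d : ℕ} (hd : d ≠ 0) {F : Fin 2 → MvPolynomial (Fin 2) k}
    {f : RatFunc k} (hf : IsLift d F f) :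
    ∃ c : k, c ≠ 0 ∧ f.num = Polynomial.C c * dehom (F 0) ∧
      f.denom = Polynomial.C c * dehom (F 1) := by
  have h1 := hf.dehom_ne_zero hd
  have hcross : f.num * dehom (F 1) = dehom (F 0) * f.denom := by
    have := hf.eq
    conv_lhs at this => rw [← RatFunc.num_div_denom f]
    rw [div_eq_div_iff (RatFunc.algebraMap_ne_zero f.denom_ne_zero)
      (RatFunc.algebraMap_ne_zero h1), ← map_mul, ← map_mul] at this
    exact RatFunc.algebraMap_injective k this
  have hass : Associated (dehom (F 1)) f.denom := by
    refine associated_of_dvd_dvd ?_ ?_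
    · exact hf.isCoprime.symm.dvd_of_dvd_mul_left (hcross ▸ dvd_mul_left _ _)
    · exact f.isCoprime_num_denom.symm.dvd_of_dvd_mul_left (hcross ▸ dvd_mul_left _ _)
  obtain ⟨u, hu⟩ := hass
  obtain ⟨c, hc, hcu⟩ := Polynomial.isUnit_iff.mp u.isUnit
  have hden : f.denom = Polynomial.C c * dehom (F 1) := by rw [hcu, mul_comm, hu]
  refine ⟨c, hc.ne_zero, ?_, hden⟩
  apply mul_right_cancel₀ h1
  rw [hcross, hden]
  ring

end Lift
section Point

variable {k : Type*} [Field k]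

open scoped Classical in
/-- The point of the projective line with homogeneous coordinates `v`. -/
noncomputable def pt (v : Fin 2 → k) : OnePoint k :=
  if v 1 = 0 then OnePoint.infty else ((v 0 / v 1 : k) : OnePoint k)

theorem pt_of_eq_zero {v : Fin 2 → k} (h : v 1 = 0) : pt v = OnePoint.infty := if_pos h

theorem pt_of_ne_zero {v : Fin 2 → k} (h : v 1 ≠ 0) : pt v = ((v 0 / v 1 : k) : OnePoint k) :=
  if_neg h

@[simp] theorem pt_infty : pt ![(1 : k), 0] = OnePoint.infty := by simp [pt]

@[simp] theorem pt_coe (z : k) : pt ![z, 1] = (z : OnePoint k) := by simp [pt]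

theorem pt_smul {c : k} (hc : c ≠ 0) (v : Fin 2 → k) : pt (c • v) = pt v := by
  by_cases h : v 1 = 0
  · simp [pt, h]
  · simp [pt, h, hc, mul_div_mul_left]

theorem exists_eq_smul {v : Fin 2 → k} (hv : v ≠ 0) :
    ∃ c : k, c ≠ 0 ∧ (v = c • ![1, 0] ∨ ∃ z, v = c • ![z, 1]) := by
  by_cases h : v 1 = 0
  · refine ⟨v 0, fun h0 => hv ?_, Or.inl ?_⟩
    · ext i; fin_cases i <;> simp [h, h0]
    · ext i; fin_cases i <;> simp [h]
  · refine ⟨v 1, h, Or.inr ⟨v 0 / v 1, ?_⟩⟩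
    ext i
    fin_cases i
    · simp; field_simp
    · simp

theorem exists_pt (P : OnePoint k) : ∃ v : Fin 2 → k, v ≠ 0 ∧ pt v = P := by
  induction P using OnePoint.rec with
  | infty => exact ⟨![1, 0], fun h => by simpa using congr_fun h 0, pt_infty⟩
  | coe z => exact ⟨![z, 1], fun h => by simpa using congr_fun h 1, pt_coe z⟩

theorem pt_eq_pt_iff {v w : Fin 2 → k} (hv : v ≠ 0) (hw : w ≠ 0) :
    pt v = pt w ↔ v 0 * w 1 = w 0 * v 1 := by
  by_cases h1 : v 1 = 0 <;> by_cases h2 : w 1 = 0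
  · simp [pt, h1, h2]
  · have : v 0 ≠ 0 := fun h => hv (by ext i; fin_cases i <;> simp [h, h1])
    simp [pt, h1, h2, this]
  · have : w 0 ≠ 0 := fun h => hw (by ext i; fin_cases i <;> simp [h, h2])
    simp [pt, h1, h2, this]
  · simp [pt, h1, h2, div_eq_div_iff]

theorem exists_smul_of_pt_eq {v w : Fin 2 → k} (hv : v ≠ 0) (hw : w ≠ 0) (h : pt v = pt w) :
    ∃ c : k, c ≠ 0 ∧ v = c • w := by
  rw [pt_eq_pt_iff hv hw] at h
  obtain ⟨c, hc, hv | ⟨z, hv⟩⟩ := exists_eq_smul hv <;>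
  obtain ⟨d, hd, hw | ⟨y, hw⟩⟩ := exists_eq_smul hw
  · exact ⟨c / d, by positivity, by rw [hv, hw, smul_smul, div_mul_cancel₀ _ hd]⟩
  · simp [hv, hw, hc, hd] at h
  · simp [hv, hw, hc, hd] at h
  · have : z = y := by
      simp [hv, hw] at h
      have h2 : (c * d) * (z - y) = 0 := by linear_combination h
      simpa [hc, hd, sub_eq_zero] using h2
    exact ⟨c / d, by positivity, by rw [hv, hw, this, smul_smul, div_mul_cancel₀ _ hd]⟩

theorem mulVec_ne_zero (g : GL (Fin 2) k) {v : Fin 2 → k} (hv : v ≠ 0) : g.val.mulVec v ≠ 0 := by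
  intro h
  apply hv
  have : (g⁻¹).val.mulVec (g.val.mulVec v) = v := by
    rw [Matrix.mulVec_mulVec, ← Units.val_mul, inv_mul_cancel, Units.val_one, Matrix.one_mulVec]
  rw [← this, h, Matrix.mulVec_zero]

open scoped Classical in
theorem smul_pt (g : GL (Fin 2) k) {v : Fin 2 → k} (hv : v ≠ 0) :
    g • pt v = pt (g.val.mulVec v) := by
  obtain ⟨c, hc, rfl | ⟨z, rfl⟩⟩ := exists_eq_smul hv
  · rw [Matrix.mulVec_smul, pt_smul hc, pt_smul hc, pt_infty, OnePoint.smul_infty_eq_ite]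
    simp [pt]
  · rw [Matrix.mulVec_smul, pt_smul hc, pt_smul hc, pt_coe, OnePoint.smul_some_eq_ite]
    simp [pt]

open scoped Classical in
/-- The action of `PGL₂` on the projective line. -/
noncomputable instance : MulAction PGL(2, k) (OnePoint k) :=
  Matrix.ProjGenLinGroup.mulActionOfGL (by
    intro u a
    obtain ⟨v, hv, rfl⟩ := exists_pt a
    rw [smul_pt _ hv]
    have : (Matrix.GeneralLinearGroup.scalar (Fin 2) u).val.mulVec v = (u : k) • v := by
      ext i; fin_cases i <;> simp [Matrix.GeneralLinearGroup.scalar]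
    rw [this, pt_smul u.ne_zero])

open scoped Classical in
theorem mk_smul_pt (g : GL (Fin 2) k) {v : Fin 2 → k} (hv : v ≠ 0) :
    (Matrix.ProjGenLinGroup.mk g : PGL(2, k)) • pt v = pt (g.val.mulVec v) :=
  smul_pt g hv

end Point

section Lift

open MvPolynomial (aeval eval bind₁ pderiv)

variable {k : Type*} [Field k]

/-- The self-map of `k²` given by a pair of polynomials. -/
noncomputable def evalVec (F : Fin 2 → MvPolynomial (Fin 2) k) (v : Fin 2 → k) : Fin 2 → k :=
  fun i => eval v (F i)

theorem IsLift.evalVec_smul {d : ℕ} {F : Fin 2 → MvPolynomial (Fin 2) k} {f : RatFunc k}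
    (hf : IsLift d F f) (c : k) (v : Fin 2 → k) : evalVec F (c • v) = c ^ d • evalVec F v := by
  ext i
  have := (hf.hom i).aeval_mul_left c v
  exact this

theorem IsLift.evalVec_ne_zero {d : ℕ} {F : Fin 2 → MvPolynomial (Fin 2) k} {f : RatFunc k}
    (hf : IsLift d F f) {v : Fin 2 → k} (hv : v ≠ 0) : evalVec F v ≠ 0 :=
  fun h => hv (hf.nz v fun i => congr_fun h i)

/-- The divergence of a polynomial vector field on the plane. -/
noncomputable def divergence (F : Fin 2 → MvPolynomial (Fin 2) k) : MvPolynomial (Fin 2) k :=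
  pderiv 0 (F 0) + pderiv 1 (F 1)

theorem pderiv_bind₁ {σ τ R : Type*} [CommRing R] [Fintype σ] (G : σ → MvPolynomial τ R) (i : τ)
    (P : MvPolynomial σ R) :
    pderiv i (bind₁ G P) = ∑ l, bind₁ G (pderiv l P) * pderiv i (G l) := by
  classical
  induction P using MvPolynomial.induction_on with
  | C a => simp
  | add p q hp hq => simp [hp, hq, add_mul, Finset.sum_add_distrib]
  | mul_X p j hp =>
    have hs : ∑ l, bind₁ G (pderiv l (MvPolynomial.X j : MvPolynomial σ R)) * pderiv i (G l) =
        pderiv i (G j) := by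
      rw [Finset.sum_eq_single j]
      · simp
      · intro b _ hb
        simp [MvPolynomial.pderiv_X_of_ne hb.symm]
      · simp
    simp only [map_mul, Derivation.leibniz, hp, MvPolynomial.bind₁_X_right, smul_eq_mul,
      map_add, add_mul, Finset.sum_add_distrib, mul_assoc, ← Finset.mul_sum, hs]

theorem IsLift.inv {d : ℕ} {F : Fin 2 → MvPolynomial (Fin 2) k} {f : RatFunc k}
    (hf : IsLift d F f) : IsLift d ![F 1, F 0] f⁻¹ where
  hom i := by fin_cases i; exacts [hf.hom 1, hf.hom 0]
  nz v h := hf.nz v fun i => by fin_cases i; exacts [h 1, h 0]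
  eq := by rw [hf.eq, inv_div]; rfl

variable [IsAlgClosed k]

theorem IsLift.evalP1_pt {d : ℕ} (hd : d ≠ 0) {F : Fin 2 → MvPolynomial (Fin 2) k}
    {f : RatFunc k} (hf : IsLift d F f) {v : Fin 2 → k} (hv : v ≠ 0) :
    evalP1 f (pt v) = pt (evalVec F v) := by
  obtain ⟨u, hu, hnum, hden⟩ := hf.exists_num_denom hd
  obtain ⟨c, hc, rfl | ⟨z, rfl⟩⟩ := exists_eq_smul hv
  · rw [pt_smul hc, hf.evalVec_smul, pt_smul (pow_ne_zero _ hc), pt_infty]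
    simp only [evalP1, hnum, hden, Polynomial.natDegree_C_mul hu, Polynomial.coeff_C_mul,
      Polynomial.leadingCoeff_mul, Polynomial.leadingCoeff_C]
    have h0 := natDegree_dehom_le (hf.hom 0)
    have h1 := natDegree_dehom_le (hf.hom 1)
    have c0 := coeff_dehom (hf.hom 0)
    have c1 := coeff_dehom (hf.hom 1)
    have hne := hf.dehom_ne_zero hd
    by_cases h : eval ![1, 0] (F 1) = 0
    · have h1' : (dehom (F 1)).natDegree < d := by
        refine lt_of_le_of_ne h1 fun e => ?_
        rw [h, ← e] at c1
        exact hne (Polynomial.leadingCoeff_eq_zero.mp c1)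
      have h0' : (dehom (F 0)).natDegree = d := by
        refine le_antisymm h0 (Polynomial.le_natDegree_of_ne_zero ?_)
        rw [c0]
        intro h'
        have := hf.nz ![1, 0] (by intro i; fin_cases i; exacts [h', h])
        simpa using congr_fun this 0
      rw [if_pos (by omega)]
      simp [pt, evalVec, h]
    · have h1' : (dehom (F 1)).natDegree = d :=
        le_antisymm h1 (Polynomial.le_natDegree_of_ne_zero (by rwa [c1]))
      rw [if_neg (by omega)]
      simp only [Polynomial.leadingCoeff, h1', c0, c1]
      rw [mul_div_mul_left _ _ hu, pt_of_ne_zero h]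
      rfl
  · rw [pt_smul hc, hf.evalVec_smul, pt_smul (pow_ne_zero _ hc), pt_coe]
    have h0 : f.num.eval z = u * eval ![z, 1] (F 0) := by simp [hnum, eval_dehom]
    have h1 : f.denom.eval z = u * eval ![z, 1] (F 1) := by simp [hden, eval_dehom]
    by_cases h : eval ![z, 1] (F 1) = 0
    · rw [pt_of_eq_zero h]
      exact if_pos (by rw [h1, h, mul_zero])
    · rw [pt_of_ne_zero h]
      refine (if_neg (by rw [h1]; exact mul_ne_zero hu h)).trans ?_
      rw [h0, h1, mul_div_mul_left _ _ hu]
      rfl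

theorem IsLift.comp {d e : ℕ} (hd : d ≠ 0) (he : e ≠ 0) {F G : Fin 2 → MvPolynomial (Fin 2) k}
    {f g : RatFunc k} (hf : IsLift d F f) (hg : IsLift e G g) :
    IsLift (e * d) (fun i => bind₁ G (F i)) (comp f g) where
  hom i := (hf.hom i).aeval G hg.hom
  nz v h := by
    by_contra hv
    refine hf.evalVec_ne_zero (hg.evalVec_ne_zero hv) (funext fun i => ?_)
    have := h i
    rwa [← MvPolynomial.aeval_eq_eval, MvPolynomial.aeval_bind₁, MvPolynomial.aeval_eq_eval] at this
  eq := by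
    obtain ⟨u, hu, hnum, hden⟩ := hf.exists_num_denom hd
    set B := algebraMap k[X] (RatFunc k) (dehom (G 1)) with hB
    have hB0 : B ≠ 0 := RatFunc.algebraMap_ne_zero (hg.dehom_ne_zero he)
    have key : ∀ i, B ^ d * Polynomial.eval₂ RatFunc.C g (dehom (F i)) =
        algebraMap k[X] (RatFunc k) (dehom (bind₁ G (F i))) := by
      intro i
      have h1 : ∀ P : MvPolynomial (Fin 2) k,
          Polynomial.eval₂ RatFunc.C g (dehom P) = aeval ![g, 1] P := by
        intro P
        induction P using MvPolynomial.induction_on with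
        | C a => simp [dehom, RatFunc.algebraMap_eq_C]
        | add p q hp hq => simp [Polynomial.eval₂_add, hp, hq]
        | mul_X p j hp =>
          rw [map_mul, Polynomial.eval₂_mul, hp, map_mul]
          fin_cases j <;> simp [dehom]
      have h2 : (fun j => B * (![g, 1] : Fin 2 → RatFunc k) j) =
          fun j => algebraMap k[X] (RatFunc k) (dehom (G j)) := by
        ext j
        fin_cases j
        · simp only [hg.eq, Fin.zero_eta, Matrix.cons_val_zero]
          rw [mul_div_cancel₀ _ hB0]
        · simp [hB]
      rw [h1, ← (hf.hom i).aeval_mul_left, h2]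
      rw [MvPolynomial.aeval_bind₁]
      have := MvPolynomial.aeval_algebraMap_apply (B := RatFunc k) (fun j => dehom (G j)) (F i)
      exact this
    rw [RatDyn.comp, RatFunc.eval, hnum, hden, Polynomial.eval₂_mul, Polynomial.eval₂_mul,
      Polynomial.eval₂_C, mul_div_mul_left _ _ (by simpa using hu), ← key, ← key,
      mul_div_mul_left _ _ (pow_ne_zero _ hB0)]

end Lift
section Multiplier

open MvPolynomial (aeval eval bind₁ pderiv)

variable {k : Type*} [Field k]

theorem derivative_dehom (P : MvPolynomial (Fin 2) k) :
    (dehom P).derivative = dehom (pderiv 0 P) := by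
  induction P using MvPolynomial.induction_on with
  | C a => simp [dehom]
  | add p q hp hq => simp [hp, hq]
  | mul_X p i hp =>
    rw [map_mul, Polynomial.derivative_mul, hp, Derivation.leibniz]
    fin_cases i
    · simp [dehom]; ring
    · simp [dehom]

theorem IsLift.exists_of_degree {f : RatFunc k} :
    ∃ F : Fin 2 → MvPolynomial (Fin 2) k, IsLift (degree f) F f := by
  have h0 : f.num.natDegree ≤ degree f := le_max_left _ _
  have h1 : f.denom.natDegree ≤ degree f := le_max_right _ _
  have hh : ∀ p : k[X], p.natDegree ≤ degree f → dehom (p.homogenize (degree f)) = p :=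
    fun p hp => Polynomial.aeval_homogenize_X_one p hp
  refine ⟨![f.num.homogenize (degree f), f.denom.homogenize (degree f)], ?_, ?_, ?_⟩
  · intro i
    fin_cases i <;> simp
  · intro v hv
    have e0 : eval v (f.num.homogenize (degree f)) = 0 := hv 0
    have e1 : eval v (f.denom.homogenize (degree f)) = 0 := hv 1
    by_contra hne
    obtain ⟨c, hc, h | ⟨z, h⟩⟩ := exists_eq_smul hne
    · have key : ∀ p : k[X], p.natDegree ≤ degree f → eval v (p.homogenize (degree f)) = 0 →
          p.coeff (degree f) = 0 := by
        intro p hp hv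
        have h2 := (Polynomial.isHomogeneous_homogenize (n := degree f) p).aeval_mul_left c ![1, 0]
        have h3 := coeff_dehom (Polynomial.isHomogeneous_homogenize (n := degree f) p)
        rw [hh p hp] at h3
        rw [h3]
        have h4 : eval v (p.homogenize (degree f)) =
          c ^ degree f * eval ![1, 0] (p.homogenize (degree f)) := by rw [h]; exact h2
        rw [hv] at h4
        simpa [hc] using h4.symm
      rcases max_choice f.num.natDegree f.denom.natDegree with hm | hm
      · have h5 := key _ h0 e0
        rw [degree, hm, Polynomial.coeff_natDegree, Polynomial.leadingCoeff_eq_zero] at h5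
        have h6 := key _ h1 e1
        have h7 : f.denom.natDegree ≤ 0 := by
          have : f.denom.natDegree ≤ f.num.natDegree := hm ▸ le_max_right _ _
          rwa [h5, Polynomial.natDegree_zero] at this
        have h8 : degree f = f.denom.natDegree := by
          rw [degree, hm, h5, Polynomial.natDegree_zero]; omega
        rw [h8, Polynomial.coeff_natDegree, Polynomial.leadingCoeff_eq_zero] at h6
        exact f.denom_ne_zero h6
      · have h6 := key _ h1 e1
        rw [degree, hm, Polynomial.coeff_natDegree, Polynomial.leadingCoeff_eq_zero] at h6
        exact f.denom_ne_zero h6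
    · have hv1 : v 1 ≠ 0 := by simpa [h] using hc
      rw [Polynomial.eval_homogenize h0 v hv1, mul_eq_zero, or_iff_left (pow_ne_zero _ hv1)] at e0
      rw [Polynomial.eval_homogenize h1 v hv1, mul_eq_zero, or_iff_left (pow_ne_zero _ hv1)] at e1
      obtain ⟨a, b, hab⟩ := f.isCoprime_num_denom
      have := congrArg (Polynomial.eval (v 0 / v 1)) hab
      simp [e0, e1] at this
  · simp only [Matrix.cons_val_zero, Matrix.cons_val_one]
    rw [hh _ h0, hh _ h1, RatFunc.num_div_denom]

variable [IsAlgClosed k]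

theorem IsLift.derivAt_eq {d : ℕ} (hd : d ≠ 0) {F : Fin 2 → MvPolynomial (Fin 2) k}
    {f : RatFunc k} (hf : IsLift d F f) {z c : k} (hc : c ≠ 0)
    (h : evalVec F ![z, 1] = c • ![z, 1]) :
    derivAt f z = eval ![z, 1] (divergence F) / c - d := by
  obtain ⟨u, hu, hnum, hden⟩ := hf.exists_num_denom hd
  have h0 : eval ![z, 1] (F 0) = c * z := by simpa [evalVec] using congr_fun h 0
  have h1 : eval ![z, 1] (F 1) = c := by simpa [evalVec] using congr_fun h 1
  have euler := congrArg (eval ![z, 1]) (hf.hom 1).sum_X_mul_pderiv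
  simp [h1] at euler
  simp only [derivAt, hnum, hden, Polynomial.derivative_C_mul, derivative_dehom,
    Polynomial.eval_mul, Polynomial.eval_C, eval_dehom, h0, h1, divergence, map_add]
  field_simp
  linear_combination -euler

theorem IsLift.multiplier_pt {d : ℕ} (hd : d ≠ 0) {F : Fin 2 → MvPolynomial (Fin 2) k}
    {f : RatFunc k} (hf : IsLift d F f) {v : Fin 2 → k} (hv : v ≠ 0) {c : k}
    (h : evalVec F v = c • v) :
    multiplier f (pt v) = eval v (divergence F) / c - d := by
  have hc : c ≠ 0 := by
    rintro rfl
    exact hf.evalVec_ne_zero hv (by simpa using h)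
  have hdiv : (divergence F).IsHomogeneous (d - 1) := (hf.hom 0).pderiv.add (hf.hom 1).pderiv
  have scale : ∀ (t : k) (w : Fin 2 → k), t ≠ 0 → v = t • w →
      evalVec F w = (c / t ^ (d - 1)) • w ∧ eval v (divergence F) / c =
        eval w (divergence F) / (c / t ^ (d - 1)) := by
    intro t w ht hw
    subst hw
    constructor
    · rw [hf.evalVec_smul, smul_smul] at h
      have hp : t ^ d = t ^ (d - 1) * t := by rw [← pow_succ, Nat.sub_one_add_one hd]
      have htd := pow_ne_zero (d - 1) ht
      have : evalVec F w = (t ^ d)⁻¹ • (t ^ d • evalVec F w) := by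
        rw [smul_smul, inv_mul_cancel₀ (pow_ne_zero _ ht), one_smul]
      rw [this, h, smul_smul, hp]
      congr 1
      field_simp
    · have : eval (t • w) (divergence F) = t ^ (d - 1) * eval w (divergence F) :=
        hdiv.aeval_mul_left t w
      rw [this]
      field_simp
  obtain ⟨t, ht, hv | ⟨z, hv⟩⟩ := exists_eq_smul hv
  · obtain ⟨h1, h2⟩ := scale t _ ht hv
    rw [h2, hv, pt_smul ht, pt_infty]
    have hs : IsLift 1 ![MvPolynomial.X 1, MvPolynomial.X 0] (RatFunc.X⁻¹ : RatFunc k) := by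
      have hX : IsLift 1 ![MvPolynomial.X 0, MvPolynomial.X 1] (RatFunc.X : RatFunc k) := by
        refine ⟨fun i => ?_, fun v h => ?_, ?_⟩
        · fin_cases i <;> simp [MvPolynomial.isHomogeneous_X]
        · ext i
          fin_cases i
          · simpa using h 0
          · simpa using h 1
        · simp [dehom]
      exact hX.inv
    have hl := (hf.comp hd one_ne_zero hs).inv
    have hev : ∀ P : MvPolynomial (Fin 2) k,
        eval ![0, 1] (bind₁ ![MvPolynomial.X 1, MvPolynomial.X 0] P) = eval ![1, 0] P := by
      intro P
      rw [← MvPolynomial.aeval_eq_eval, MvPolynomial.aeval_bind₁, ← MvPolynomial.aeval_eq_eval]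
      congr 2
      ext i
      fin_cases i <;> simp
    have h3 : evalVec ![bind₁ ![MvPolynomial.X 1, MvPolynomial.X 0] (F 1),
        bind₁ ![MvPolynomial.X 1, MvPolynomial.X 0] (F 0)] ![0, 1] =
        (c / t ^ (d - 1)) • ![(0 : k), 1] := by
      ext i
      fin_cases i
      · simpa [evalVec, hev] using congr_fun h1 1
      · simpa [evalVec, hev] using congr_fun h1 0
    have := hl.derivAt_eq (by simpa using hd) (by positivity) h3
    refine this.trans ?_
    simp [divergence, pderiv_bind₁, Fin.sum_univ_two, hev, add_comm]
  · obtain ⟨h1, h2⟩ := scale t _ ht hv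
    rw [h2, hv, pt_smul ht, pt_coe]
    exact hf.derivAt_eq hd (by positivity) h1

end Multiplier

section Conj

open MvPolynomial (aeval eval bind₁ pderiv)

variable {k : Type*} [Field k]

/-- The linear forms of a matrix. -/
noncomputable def linForms (g : GL (Fin 2) k) : Fin 2 → MvPolynomial (Fin 2) k :=
  fun i => MvPolynomial.C (g.val i 0) * MvPolynomial.X 0 +
    MvPolynomial.C (g.val i 1) * MvPolynomial.X 1

theorem eval_linForms (g : GL (Fin 2) k) (v : Fin 2 → k) (i : Fin 2) :
    eval v (linForms g i) = g.val.mulVec v i := by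
  simp only [linForms, map_add, map_mul, MvPolynomial.eval_C, MvPolynomial.eval_X,
    Matrix.mulVec, dotProduct, Fin.sum_univ_two]

theorem isLift_mobius (g : GL (Fin 2) k) : IsLift 1 (linForms g) (mobius g) where
  hom i := (MvPolynomial.isHomogeneous_C_mul_X _ _).add (MvPolynomial.isHomogeneous_C_mul_X _ _)
  nz v h := by
    by_contra hv
    exact mulVec_ne_zero g hv (funext fun i => by rw [← eval_linForms]; exact h i)
  eq := by
    simp [mobius, linForms, dehom, ← RatFunc.algebraMap_eq_C]

/-- The homogeneous lift `g⁻¹ ∘ F ∘ g`. -/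
noncomputable def conjLift (g : GL (Fin 2) k) (F : Fin 2 → MvPolynomial (Fin 2) k) :
    Fin 2 → MvPolynomial (Fin 2) k :=
  fun i => bind₁ (fun j => bind₁ (linForms g) (F j)) (linForms g⁻¹ i)

theorem conjLift_apply (g : GL (Fin 2) k) (F : Fin 2 → MvPolynomial (Fin 2) k) (i : Fin 2) :
    conjLift g F i = MvPolynomial.C ((g⁻¹).val i 0) * bind₁ (linForms g) (F 0) +
      MvPolynomial.C ((g⁻¹).val i 1) * bind₁ (linForms g) (F 1) := by
  rw [conjLift, linForms]
  simp only [map_add, map_mul, MvPolynomial.bind₁_C_right, MvPolynomial.bind₁_X_right]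

theorem eval_bind₁_linForms (g : GL (Fin 2) k) (v : Fin 2 → k) (P : MvPolynomial (Fin 2) k) :
    eval v (bind₁ (linForms g) P) = eval (g.val.mulVec v) P := by
  rw [← MvPolynomial.aeval_eq_eval, MvPolynomial.aeval_bind₁]
  have : (fun i => aeval v (linForms g i)) = g.val.mulVec v := funext fun i => eval_linForms g v i
  rw [this, MvPolynomial.aeval_eq_eval]

theorem evalVec_conjLift (g : GL (Fin 2) k) (F : Fin 2 → MvPolynomial (Fin 2) k)
    (v : Fin 2 → k) :
    evalVec (conjLift g F) v = (g⁻¹).val.mulVec (evalVec F (g.val.mulVec v)) := by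
  ext i
  rw [evalVec, conjLift_apply]
  simp only [map_add, map_mul, MvPolynomial.eval_C, eval_bind₁_linForms, Matrix.mulVec,
    dotProduct, Fin.sum_univ_two, evalVec]

theorem conjLift_conjLift (g h : GL (Fin 2) k) (F : Fin 2 → MvPolynomial (Fin 2) k) :
    conjLift h (conjLift g F) = conjLift (g * h) F := by
  have h1 : ∀ P : MvPolynomial (Fin 2) k,
      bind₁ (linForms h) (bind₁ (linForms g) P) = bind₁ (linForms (g * h)) P := by
    intro P
    rw [MvPolynomial.bind₁_bind₁]
    have : (fun i => bind₁ (linForms h) (linForms g i)) = linForms (g * h) := by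
      funext i
      simp only [linForms, map_add, map_mul, MvPolynomial.bind₁_C_right,
        MvPolynomial.bind₁_X_right, Units.val_mul, Matrix.mul_apply, Fin.sum_univ_two]
      ring
    rw [this]
  funext i
  simp only [conjLift_apply, map_add, map_mul, MvPolynomial.bind₁_C_right, h1, mul_inv_rev,
    Units.val_mul, Matrix.mul_apply, Fin.sum_univ_two]
  ring

theorem conjLift_one (F : Fin 2 → MvPolynomial (Fin 2) k) : conjLift 1 F = F := by
  have : linForms (1 : GL (Fin 2) k) = MvPolynomial.X := by
    funext i
    fin_cases i <;> simp [linForms]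
  funext i
  simp [conjLift, this]

theorem eval_divergence_conjLift (g : GL (Fin 2) k) (F : Fin 2 → MvPolynomial (Fin 2) k)
    (v : Fin 2 → k) :
    eval v (divergence (conjLift g F)) = eval (g.val.mulVec v) (divergence F) := by
  have hpd : ∀ i j, eval v (pderiv i (linForms g j)) = g.val j i := by
    intro i j
    fin_cases i <;> simp [linForms]
  have hinv : g.val * (g⁻¹).val = 1 := by rw [← Units.val_mul, mul_inv_cancel, Units.val_one]
  have e00 := congr_fun (congr_fun hinv 0) 0
  have e01 := congr_fun (congr_fun hinv 0) 1
  have e10 := congr_fun (congr_fun hinv 1) 0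
  have e11 := congr_fun (congr_fun hinv 1) 1
  simp only [Matrix.mul_apply, Fin.sum_univ_two, Matrix.one_apply_eq, ne_eq, zero_ne_one,
    one_ne_zero, not_false_eq_true, Matrix.one_apply_ne] at e00 e01 e10 e11
  simp only [divergence, conjLift_apply, map_add, MvPolynomial.pderiv_C_mul, pderiv_bind₁, Fin.sum_univ_two,
    map_mul, eval_bind₁_linForms, hpd, MvPolynomial.eval_C]
  linear_combination (eval (g.val.mulVec v) (pderiv 0 (F 0))) * e00 +
    (eval (g.val.mulVec v) (pderiv 0 (F 1))) * e01 +
    (eval (g.val.mulVec v) (pderiv 1 (F 0))) * e10 +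
    (eval (g.val.mulVec v) (pderiv 1 (F 1))) * e11

variable [IsAlgClosed k]

theorem IsLift.conjGL {d : ℕ} (hd : d ≠ 0) {F : Fin 2 → MvPolynomial (Fin 2) k} {f : RatFunc k}
    (hf : IsLift d F f) (g : GL (Fin 2) k) : IsLift d (conjLift g F) (conjGL f g) := by
  have h := hf.comp hd one_ne_zero (isLift_mobius g)
  rw [one_mul] at h
  have h2 := (isLift_mobius g⁻¹).comp one_ne_zero hd h
  rwa [mul_one] at h2

theorem conj_mul {f : RatFunc k} (hf : degree f ≠ 0) (ρ τ : PGL(2, k)) :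
    conj f (ρ * τ) = conj (conj f ρ) τ := by
  induction ρ using Matrix.ProjGenLinGroup.induction_on with | mk g =>
  induction τ using Matrix.ProjGenLinGroup.induction_on with | mk h =>
  obtain ⟨F, hF⟩ := IsLift.exists_of_degree (f := f)
  rw [← map_mul, conj_mk, conj_mk, conj_mk]
  refine (hF.conjGL hf (g * h)).unique ?_
  rw [← conjLift_conjLift]
  exact (hF.conjGL hf g).conjGL hf h

theorem conj_one {f : RatFunc k} (hf : degree f ≠ 0) : conj f 1 = f := by
  obtain ⟨F, hF⟩ := IsLift.exists_of_degree (f := f)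
  have := hF.conjGL hf 1
  rw [conjLift_one] at this
  rw [← Matrix.ProjGenLinGroup.mk_one, conj_mk]
  exact this.unique hF

theorem mem_fixedPts_conj {f : RatFunc k} (hf : degree f ≠ 0) (ρ : PGL(2, k)) (P : OnePoint k) :
    P ∈ fixedPts (conj f ρ) ↔ ρ • P ∈ fixedPts f := by
  induction ρ using Matrix.ProjGenLinGroup.induction_on with | mk g =>
  obtain ⟨F, hF⟩ := IsLift.exists_of_degree (f := f)
  obtain ⟨v, hv, rfl⟩ := exists_pt P
  have hgv := mulVec_ne_zero g hv
  simp only [fixedPts, Set.mem_ofPred_eq, conj_mk]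
  rw [(hF.conjGL hf g).evalP1_pt hf hv, evalVec_conjLift, mk_smul_pt g hv, hF.evalP1_pt hf hgv,
    ← mk_smul_pt _ (hF.evalVec_ne_zero hgv), map_inv, inv_smul_eq_iff, mk_smul_pt g hv]

theorem IsLift.exists_eigen {d : ℕ} (hd : d ≠ 0) {F : Fin 2 → MvPolynomial (Fin 2) k}
    {f : RatFunc k} (hf : IsLift d F f) {v : Fin 2 → k} (hv : v ≠ 0) (h : pt v ∈ fixedPts f) :
    ∃ c : k, evalVec F v = c • v := by
  rw [fixedPts, Set.mem_ofPred_eq, hf.evalP1_pt hd hv] at h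
  obtain ⟨c, -, hc⟩ := exists_smul_of_pt_eq (hf.evalVec_ne_zero hv) hv h
  exact ⟨c, hc⟩

theorem multiplier_conj {f : RatFunc k} (hf : degree f ≠ 0) (ρ : PGL(2, k)) {P : OnePoint k}
    (hP : ρ • P ∈ fixedPts f) : multiplier (conj f ρ) P = multiplier f (ρ • P) := by
  induction ρ using Matrix.ProjGenLinGroup.induction_on with | mk g =>
  obtain ⟨F, hF⟩ := IsLift.exists_of_degree (f := f)
  obtain ⟨v, hv, rfl⟩ := exists_pt P
  have hgv := mulVec_ne_zero g hv
  rw [mk_smul_pt g hv] at hP ⊢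
  obtain ⟨c, hc⟩ := hF.exists_eigen hf hgv hP
  rw [hF.multiplier_pt hf hgv hc, conj_mk, (hF.conjGL hf g).multiplier_pt hf hv (c := c),
    eval_divergence_conjLift]
  rw [evalVec_conjLift, hc, Matrix.mulVec_smul, Matrix.mulVec_mulVec, ← Units.val_mul,
    inv_mul_cancel, Units.val_one, Matrix.one_mulVec]

end Conj
section Coefficients

open MvPolynomial (aeval eval bind₁ pderiv)

variable {k : Type*} [Field k]

/-- The action of a field automorphism on the coefficients of a rational function. -/
noncomputable def mapCoeff (s : k ≃+* k) (f : RatFunc k) : RatFunc k :=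
  RatFunc.map (Polynomial.mapRingHom s.toRingHom)
    (nonZeroDivisors_le_comap_nonZeroDivisors_of_injective _
      (Polynomial.map_injective _ s.injective)) f

theorem mapCoeff_div (s : k ≃+* k) (p q : k[X]) :
    mapCoeff s (algebraMap k[X] (RatFunc k) p / algebraMap k[X] (RatFunc k) q) =
      algebraMap k[X] (RatFunc k) (p.map s.toRingHom) /
        algebraMap k[X] (RatFunc k) (q.map s.toRingHom) :=
  RatFunc.map_apply_div _ _ _ _

/-- The action of a field automorphism on `PGL₂`. -/
noncomputable def mapPGL (s : k ≃+* k) : PGL(2, k) →* PGL(2, k) :=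
  Matrix.ProjGenLinGroup.map s.toRingHom

theorem eval_map_comp (s : k ≃+* k) (P : MvPolynomial (Fin 2) k) (v : Fin 2 → k) :
    eval (s ∘ v) (MvPolynomial.map s.toRingHom P) = s (eval v P) :=
  (MvPolynomial.map_eval s.toRingHom v P).symm

theorem comp_ne_zero (s : k ≃+* k) {v : Fin 2 → k} (hv : v ≠ 0) : s ∘ v ≠ 0 := by
  intro h
  exact hv (funext fun i => by simpa using congr_fun h i)

theorem IsLift.map {d : ℕ} {F : Fin 2 → MvPolynomial (Fin 2) k} {f : RatFunc k}
    (hf : IsLift d F f) (s : k ≃+* k) :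
    IsLift d (fun i => MvPolynomial.map s.toRingHom (F i)) (mapCoeff s f) where
  hom i := (hf.hom i).map _
  nz v h := by
    have hv : v = s ∘ (s.symm ∘ v) := by ext i; simp
    by_contra hne
    apply comp_ne_zero s.symm hne
    refine hf.nz _ fun i => ?_
    have := h i
    rw [hv, eval_map_comp] at this
    simpa using this
  eq := by
    have key : ∀ P : MvPolynomial (Fin 2) k,
        (dehom P).map s.toRingHom = dehom (MvPolynomial.map s.toRingHom P) := by
      intro P
      induction P using MvPolynomial.induction_on with
      | C a => simp [dehom]
      | add p q hp hq => simp only [map_add, Polynomial.map_add, hp, hq]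
      | mul_X p i hp =>
        simp only [map_mul, Polynomial.map_mul, hp, MvPolynomial.map_X]
        fin_cases i <;> simp [dehom]
    rw [hf.eq, mapCoeff_div, key, key]

theorem map_pt (s : k ≃+* k) (v : Fin 2 → k) : OnePoint.map s (pt v) = pt (s ∘ v) := by
  by_cases h : v 1 = 0
  · rw [pt_of_eq_zero h, pt_of_eq_zero (by simp [h])]; rfl
  · rw [pt_of_ne_zero h, pt_of_ne_zero (by simpa using h)]
    simp

theorem map_onePoint_smul (s : k ≃+* k) (ρ : PGL(2, k)) (P : OnePoint k) :
    OnePoint.map s (ρ • P) = mapPGL s ρ • OnePoint.map s P := by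
  classical
  induction ρ using Matrix.ProjGenLinGroup.induction_on with | mk g =>
  obtain ⟨v, hv, rfl⟩ := exists_pt P
  rw [mk_smul_pt g hv, map_pt, map_pt, mapPGL, Matrix.ProjGenLinGroup.map_mk,
    mk_smul_pt _ (comp_ne_zero s hv)]
  congr 1
  ext i
  fin_cases i <;> simp

theorem evalVec_map (s : k ≃+* k) (F : Fin 2 → MvPolynomial (Fin 2) k) (v : Fin 2 → k) :
    evalVec (fun i => MvPolynomial.map s.toRingHom (F i)) (s ∘ v) = s ∘ evalVec F v :=
  funext fun i => eval_map_comp s (F i) v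

variable [IsAlgClosed k]

theorem map_mem_fixedPts {f : RatFunc k} (hf : degree f ≠ 0) {s : k ≃+* k}
    (hs : mapCoeff s f = f) {P : OnePoint k} (hP : P ∈ fixedPts f) :
    OnePoint.map s P ∈ fixedPts f := by
  obtain ⟨F, hF⟩ := IsLift.exists_of_degree (f := f)
  have hF' := hF.map s
  rw [hs] at hF'
  obtain ⟨v, hv, rfl⟩ := exists_pt P
  rw [fixedPts, Set.mem_ofPred_eq, hF.evalP1_pt hf hv] at hP
  rw [fixedPts, Set.mem_ofPred_eq, map_pt, hF'.evalP1_pt hf (comp_ne_zero s hv), evalVec_map,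
    ← map_pt, hP, map_pt]

theorem multiplier_map {f : RatFunc k} (hf : degree f ≠ 0) {s : k ≃+* k}
    (hs : mapCoeff s f = f) {P : OnePoint k} (hP : P ∈ fixedPts f) :
    multiplier f (OnePoint.map s P) = s (multiplier f P) := by
  obtain ⟨F, hF⟩ := IsLift.exists_of_degree (f := f)
  have hF' := hF.map s
  rw [hs] at hF'
  obtain ⟨v, hv, rfl⟩ := exists_pt P
  obtain ⟨c, hc⟩ := hF.exists_eigen hf hv hP
  rw [map_pt, hF.multiplier_pt hf hv hc, hF'.multiplier_pt hf (comp_ne_zero s hv) (c := s c)]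
  · have : divergence (fun i => MvPolynomial.map s.toRingHom (F i)) =
        MvPolynomial.map s.toRingHom (divergence F) := by
      simp only [divergence, map_add, MvPolynomial.pderiv_map]
    rw [this, eval_map_comp]
    simp
  · rw [evalVec_map, hc]
    ext i
    simp

theorem mapCoeff_conj {f : RatFunc k} (hf : degree f ≠ 0) (s : k ≃+* k) (ρ : PGL(2, k)) :
    mapCoeff s (conj f ρ) = conj (mapCoeff s f) (mapPGL s ρ) := by
  induction ρ using Matrix.ProjGenLinGroup.induction_on with | mk g =>
  obtain ⟨F, hF⟩ := IsLift.exists_of_degree (f := f)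
  rw [mapPGL, Matrix.ProjGenLinGroup.map_mk, conj_mk, conj_mk]
  refine ((hF.conjGL hf g).map s).unique ?_
  have h := (hF.map s).conjGL hf (Matrix.GeneralLinearGroup.map s.toRingHom g)
  convert h using 1
  have hl : ∀ h : GL (Fin 2) k, (fun i => MvPolynomial.map s.toRingHom (linForms h i)) =
      linForms (Matrix.GeneralLinearGroup.map s.toRingHom h) := by
    intro h
    funext i
    simp [linForms]
  funext i
  simp only [conjLift, MvPolynomial.map_bind₁, ← map_inv, hl]
  rw [congr_fun (hl g⁻¹) i]

end Coefficients

section Galois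

variable {K k : Type*} [Field K] [Field k] [Algebra K k]

theorem isDefinedOver_iff [IsGalois K k] (f : RatFunc k) :
    IsDefinedOver K f ↔ ∀ σ : k ≃ₐ[K] k, mapCoeff σ.toRingEquiv f = f := by
  constructor
  · rintro ⟨p, q, -, rfl⟩ σ
    have : ∀ p : K[X], (p.map (algebraMap K k)).map (σ.toRingEquiv).toRingHom =
        p.map (algebraMap K k) := by
      intro p
      rw [Polynomial.map_map]
      congr 1
      ext x
      simp
    rw [mapCoeff_div, this, this]
  · intro h
    have key : ∀ σ : k ≃ₐ[K] k, f.num.map (σ.toRingEquiv).toRingHom = f.num ∧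
        f.denom.map (σ.toRingEquiv).toRingHom = f.denom := by
      intro σ
      set s := (σ.toRingEquiv).toRingHom with hs
      have h1 := h σ
      have hmon : (f.denom.map s).Monic := f.monic_denom.map s
      conv_lhs at h1 => rw [← RatFunc.num_div_denom f]
      rw [mapCoeff_div, ← hs, ← RatFunc.num_div_denom f,
        div_eq_div_iff (RatFunc.algebraMap_ne_zero (by simpa using hmon.ne_zero))
        (RatFunc.algebraMap_ne_zero (by simpa using f.denom_ne_zero)), ← map_mul, ← map_mul] at h1
      simp only [RatFunc.num_div_denom] at h1
      have h2 := RatFunc.algebraMap_injective k h1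
      have hc : IsCoprime (f.num.map s) (f.denom.map s) :=
        f.isCoprime_num_denom.map (Polynomial.mapRingHom s)
      have hd : f.denom.map s = f.denom := by
        refine Polynomial.eq_of_monic_of_associated hmon f.monic_denom
          (associated_of_dvd_dvd ?_ ?_)
        · exact hc.symm.dvd_of_dvd_mul_left (h2 ▸ dvd_mul_left _ _)
        · exact f.isCoprime_num_denom.symm.dvd_of_dvd_mul_left (h2 ▸ dvd_mul_left _ _)
      rw [hd] at h2
      exact ⟨mul_right_cancel₀ f.denom_ne_zero h2, hd⟩
    have lift : ∀ p : k[X], (∀ σ : k ≃ₐ[K] k, p.map (σ.toRingEquiv).toRingHom = p) →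
        ∃ q : K[X], q.map (algebraMap K k) = p := by
      intro p hp
      rw [← Polynomial.mem_lifts, Polynomial.lifts_iff_coeff_lifts]
      intro n
      rw [InfiniteGalois.mem_range_algebraMap_iff_fixed]
      intro σ
      have := congrArg (fun q => Polynomial.coeff q n) (hp σ)
      simpa using this
    obtain ⟨p, hp⟩ := lift f.num fun σ => (key σ).1
    obtain ⟨q, hq⟩ := lift f.denom fun σ => (key σ).2
    refine ⟨p, q, ?_, ?_⟩
    · rintro rfl
      exact f.denom_ne_zero (by rw [← hq, Polynomial.map_zero])
    · rw [hp, hq, RatFunc.num_div_denom]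

theorem isDefinedOverPGL_iff [IsGalois K k] (ρ : PGL(2, k)) :
    IsDefinedOverPGL K ρ ↔ ∀ σ : k ≃ₐ[K] k, mapPGL σ.toRingEquiv ρ = ρ := by
  constructor
  · rintro ⟨τ, rfl⟩ σ
    induction τ using Matrix.ProjGenLinGroup.induction_on with | mk g =>
    rw [mapPGL, Matrix.ProjGenLinGroup.map_mk, Matrix.ProjGenLinGroup.map_mk]
    congr 1
    ext i j
    simp
  · intro h
    induction ρ using Matrix.ProjGenLinGroup.induction_on with | mk g =>
    obtain ⟨i, j, hij⟩ : ∃ i j, g.val i j ≠ 0 := by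
      by_contra! h0
      have := g.det_ne_zero
      rw [Matrix.det_fin_two] at this
      simp [h0] at this
    set u : kˣ := Units.mk0 _ (inv_ne_zero hij)
    set g' := g * Matrix.GeneralLinearGroup.scalar (Fin 2) u with hg'
    have hmk : (Matrix.ProjGenLinGroup.mk g' : PGL(2, k)) = Matrix.ProjGenLinGroup.mk g := by
      rw [hg', map_mul, Matrix.ProjGenLinGroup.mk_scalar, mul_one]
    have hone : g'.val i j = 1 := by
      simp [hg', u, hij]
    rw [← hmk] at h ⊢
    have hfix : ∀ (σ : k ≃ₐ[K] k) (a b : Fin 2), σ (g'.val a b) = g'.val a b := by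
      intro σ
      have h1 := h σ
      rw [mapPGL, Matrix.ProjGenLinGroup.map_mk, Matrix.ProjGenLinGroup.mk_eq_mk_iff] at h1
      obtain ⟨w, hw⟩ := h1
      have hw' : ∀ a b, σ (g'.val a b) * (w : k) = g'.val a b := by
        intro a b
        have := congrArg (fun m : GL (Fin 2) k => m.val a b) hw
        simpa using this
      have hw1 : (w : k) = 1 := by simpa [hone] using hw' i j
      intro a b
      simpa [hw1] using hw' a b
    have hr : ∀ a b : Fin 2, ∃ x : K, algebraMap K k x = g'.val a b := fun a b =>
      (InfiniteGalois.mem_range_algebraMap_iff_fixed _).mpr fun σ => hfix σ a b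
    choose M hM using hr
    have hMm : (algebraMap K k).mapMatrix (Matrix.of M) = g'.val := by
      ext a b
      simp [hM]
    have hdet : (Matrix.of M).det ≠ 0 := by
      intro h0
      apply g'.det_ne_zero
      rw [← hMm, ← RingHom.map_det, h0, map_zero]
    refine ⟨Matrix.ProjGenLinGroup.mk (Matrix.GeneralLinearGroup.mkOfDetNeZero _ hdet), ?_⟩
    rw [Matrix.ProjGenLinGroup.map_mk]
    congr 1
    ext a b
    exact hM a b

end Galois
section ThreePoints

variable {k : Type*} [Field k]

theorem eq_one_of_smul_coe_eq {ρ : PGL(2, k)} {x y z : k} (hxy : x ≠ y) (hxz : x ≠ z) (hyz : y ≠ z)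
    (hx : ρ • (x : OnePoint k) = x) (hy : ρ • (y : OnePoint k) = y)
    (hz : ρ • (z : OnePoint k) = z) : ρ = 1 := by
  induction ρ using Matrix.ProjGenLinGroup.induction_on with | mk g =>
  have key : ∀ t : k, (Matrix.ProjGenLinGroup.mk g : PGL(2, k)) • (t : OnePoint k) = t →
      g.val 1 0 * t ^ 2 + (g.val 1 1 - g.val 0 0) * t - g.val 0 1 = 0 := by
    intro t ht
    have hv : (![t, 1] : Fin 2 → k) ≠ 0 := fun h => by simpa using congr_fun h 1
    rw [← pt_coe, mk_smul_pt g hv, pt_eq_pt_iff (mulVec_ne_zero g hv) hv] at ht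
    simp at ht
    linear_combination -ht
  have kx := key x hx
  have ky := key y hy
  have kz := key z hz
  have h1 : g.val 1 0 * (x + y) + (g.val 1 1 - g.val 0 0) = 0 := by
    apply mul_left_cancel₀ (sub_ne_zero.mpr hxy)
    linear_combination kx - ky
  have h2 : g.val 1 0 * (x + z) + (g.val 1 1 - g.val 0 0) = 0 := by
    apply mul_left_cancel₀ (sub_ne_zero.mpr hxz)
    linear_combination kx - kz
  have h3 : g.val 1 0 = 0 := by
    apply mul_left_cancel₀ (sub_ne_zero.mpr hyz)
    linear_combination h1 - h2
  have h4 : g.val 1 1 = g.val 0 0 := by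
    rw [h3] at h1
    linear_combination h1
  have h5 : g.val 0 1 = 0 := by
    rw [h3, h4] at kx
    linear_combination -kx
  have h6 : g.val 0 0 ≠ 0 := by
    intro h
    apply g.det_ne_zero
    rw [Matrix.det_fin_two, h, h3]
    ring
  have : g = Matrix.GeneralLinearGroup.scalar (Fin 2) (Units.mk0 _ h6) := by
    ext i j
    fin_cases i <;> fin_cases j <;> simp [h3, h4, h5]
  rw [this, Matrix.ProjGenLinGroup.mk_scalar]

theorem exists_smul_zero_one_infty {P Q R : OnePoint k} (hPQ : P ≠ Q) (hPR : P ≠ R) (hQR : Q ≠ R) :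
    ∃ ρ : PGL(2, k), ρ • (OnePoint.infty : OnePoint k) = P ∧ ρ • ((0 : k) : OnePoint k) = Q ∧
      ρ • ((1 : k) : OnePoint k) = R := by
  obtain ⟨u, hu, rfl⟩ := exists_pt P
  obtain ⟨v, hv, rfl⟩ := exists_pt Q
  obtain ⟨w, hw, rfl⟩ := exists_pt R
  rw [Ne, pt_eq_pt_iff hu hv, ← sub_eq_zero] at hPQ
  rw [Ne, pt_eq_pt_iff hu hw, ← sub_eq_zero] at hPR
  rw [Ne, pt_eq_pt_iff hv hw, ← sub_eq_zero] at hQR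
  set a := u 0 * v 1 - v 0 * u 1 with ha
  set b := u 0 * w 1 - w 0 * u 1 with hb
  set c := v 0 * w 1 - w 0 * v 1 with hc
  have hdet : (!![c * u 0, -b * v 0; c * u 1, -b * v 1] : Matrix (Fin 2) (Fin 2) k).det ≠ 0 := by
    rw [Matrix.det_fin_two_of]
    have : c * u 0 * (-b * v 1) - -b * v 0 * (c * u 1) = -(a * b * c) := by rw [ha]; ring
    rw [this]
    exact neg_ne_zero.mpr (mul_ne_zero (mul_ne_zero hPQ hPR) hQR)
  set g := Matrix.GeneralLinearGroup.mkOfDetNeZero _ hdet with hg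
  have hgv : g.val = !![c * u 0, -b * v 0; c * u 1, -b * v 1] := rfl
  refine ⟨Matrix.ProjGenLinGroup.mk g, ?_, ?_, ?_⟩
  · rw [← pt_infty, mk_smul_pt g (fun h => by simpa using congr_fun h 0), ← pt_smul hQR u, hgv]
    congr 1
    ext i
    fin_cases i <;> simp
  · rw [← pt_coe, mk_smul_pt g (fun h => by simpa using congr_fun h 1),
      ← pt_smul (neg_ne_zero.mpr hPR) v, hgv]
    congr 1
    ext i
    fin_cases i <;> simp
  · rw [← pt_coe, mk_smul_pt g (fun h => by simpa using congr_fun h 1),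
      ← pt_smul (neg_ne_zero.mpr hPQ) w, hgv]
    congr 1
    ext i
    fin_cases i
    · simp [ha, hb, hc]; ring
    · simp [ha, hb, hc]; ring

theorem exists_smul_eq_of_ne {P P' Q Q' R R' : OnePoint k} (hPQ : P ≠ Q) (hPR : P ≠ R)
    (hQR : Q ≠ R) (hPQ' : P' ≠ Q') (hPR' : P' ≠ R') (hQR' : Q' ≠ R') :
    ∃ ρ : PGL(2, k), ρ • P = P' ∧ ρ • Q = Q' ∧ ρ • R = R' := by
  obtain ⟨ρ, rfl, rfl, rfl⟩ := exists_smul_zero_one_infty hPQ hPR hQR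
  obtain ⟨τ, rfl, rfl, rfl⟩ := exists_smul_zero_one_infty hPQ' hPR' hQR'
  exact ⟨τ * ρ⁻¹, by simp [mul_smul], by simp [mul_smul], by simp [mul_smul]⟩

end ThreePoints

section Permutations

open Equiv

theorem subgroup_perm_fin_three (H : Subgroup (Perm (Fin 3))) :
    ({i : Fin 3 | ∀ h ∈ H, h i = i}.encard = 0 ∧ (Nat.card H = 3 ∨ Nat.card H = 6)) ∨
    ({i : Fin 3 | ∀ h ∈ H, h i = i}.encard = 1 ∧ Nat.card H = 2) ∨
    ({i : Fin 3 | ∀ h ∈ H, h i = i}.encard = 3 ∧ Nat.card H = 1) := by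
  have hset : {i : Fin 3 | ∀ h ∈ H, h i = i} = MulAction.fixedPoints H (Fin 3) :=
    Set.ext fun i => ⟨fun hi h => hi h.1 h.2, fun hi h hh => hi ⟨h, hh⟩⟩
  rw [hset, ← Set.Finite.cast_ncard_eq (Set.toFinite _), ← Nat.card_coe_set_eq]
  set n := Nat.card (MulAction.fixedPoints H (Fin 3)) with hn
  have hle : n ≤ 3 := (Finite.card_subtype_le _).trans (by simp)
  have hbot : n = 3 → Nat.card H = 1 := by
    intro h3
    have huniv : MulAction.fixedPoints H (Fin 3) = Set.univ := by
      apply Set.eq_of_subset_of_ncard_le (Set.subset_univ _)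
      rw [← Nat.card_coe_set_eq (MulAction.fixedPoints H (Fin 3)), ← hn, h3, Set.ncard_univ]
      simp
    rw [Subgroup.card_eq_one, Subgroup.eq_bot_iff_forall]
    intro h hh
    ext1 i
    exact (huniv ▸ Set.mem_univ i : i ∈ MulAction.fixedPoints H (Fin 3)) ⟨h, hh⟩
  have hdvd : Nat.card H ∣ 6 := by
    have := H.card_subgroup_dvd_card
    rwa [Nat.card_perm, Nat.card_fin] at this
  have hmod : ∀ p : ℕ, p.Prime → Nat.card H = p → 3 ≡ n [MOD p] := by
    intro p hp h
    have : Fact p.Prime := ⟨hp⟩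
    have := (IsPGroup.of_card (n := 1) (by rw [h, pow_one]) :
      IsPGroup p H).card_modEq_card_fixedPoints (Fin 3)
    rwa [Nat.card_eq_fintype_card, Fintype.card_fin] at this
  have hcard : Nat.card H = 1 ∨ Nat.card H = 2 ∨ Nat.card H = 3 ∨ Nat.card H = 6 := by
    have := Nat.le_of_dvd (by norm_num) hdvd
    interval_cases Nat.card H <;> simp_all
  rcases hcard with h | h | h | h
  · refine Or.inr (Or.inr ⟨?_, h⟩)
    have hH := Subgroup.card_eq_one.mp h
    have huniv : MulAction.fixedPoints H (Fin 3) = Set.univ := by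
      refine Set.eq_univ_of_forall fun i g => ?_
      have : g.1 = 1 := by simpa [hH] using g.2
      change g.1 i = i
      rw [this]
      rfl
    rw [hn, huniv]
    simp
  · have h2 := hmod 2 Nat.prime_two h
    refine Or.inr (Or.inl ⟨?_, h⟩)
    have : n ≠ 3 := fun h3 => by have := hbot h3; omega
    have h1 : n = 1 := by
      unfold Nat.ModEq at h2
      omega
    rw [h1]
    rfl
  · have h3 := hmod 3 Nat.prime_three h
    have : n ≠ 3 := fun h3 => by have := hbot h3; omega
    have h0 : n = 0 := by
      unfold Nat.ModEq at h3
      omega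
    exact Or.inl ⟨by rw [h0]; rfl, Or.inl h⟩
  · have htop : H = ⊤ := by
      apply Subgroup.eq_top_of_card_eq
      rw [h, Nat.card_perm]
      simp [Nat.factorial]
    have hempty : MulAction.fixedPoints H (Fin 3) = ∅ := by
      refine Set.eq_empty_of_forall_notMem fun i hi => ?_
      have := hi ⟨Equiv.swap i (i + 1), htop ▸ Subgroup.mem_top _⟩
      have h1 : Equiv.swap i (i + 1) i = i := this
      rw [Equiv.swap_apply_left] at h1
      revert h1
      fin_cases i <;> decide
    have h0 : n = 0 := by rw [hn, hempty]; simp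
    exact Or.inl ⟨by rw [h0]; rfl, Or.inr h⟩

end Permutations
section GaloisAction

variable {K k : Type*} [Field K] [Field k] [Algebra K k]

/-- The action of `K`-automorphisms on the projective line. -/
noncomputable instance : MulAction (k ≃ₐ[K] k) (OnePoint k) where
  smul σ P := OnePoint.map σ P
  one_smul P := by
    change OnePoint.map (id : k → k) P = P
    rw [OnePoint.map_id]; rfl
  mul_smul σ τ P := by
    change OnePoint.map (σ ∘ τ) P = OnePoint.map σ (OnePoint.map τ P)
    rw [OnePoint.map_comp]; rfl

@[simp] theorem galois_smul_coe (σ : k ≃ₐ[K] k) (z : k) :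
    σ • (z : OnePoint k) = ((σ z : k) : OnePoint k) := rfl

theorem galois_smul_smul (σ : k ≃ₐ[K] k) (ρ : PGL(2, k)) (P : OnePoint k) :
    σ • ρ • P = mapPGL σ.toRingEquiv ρ • σ • P :=
  map_onePoint_smul σ.toRingEquiv ρ P

variable [IsAlgClosed k] {f : RatFunc k}

theorem galois_smul_mem_fixedPts (hf : degree f ≠ 0)
    (hK : ∀ σ : k ≃ₐ[K] k, mapCoeff σ.toRingEquiv f = f) (σ : k ≃ₐ[K] k) {P : OnePoint k}
    (hP : P ∈ fixedPts f) : σ • P ∈ fixedPts f :=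
  map_mem_fixedPts hf (hK σ) hP

theorem multiplier_galois_smul (hf : degree f ≠ 0)
    (hK : ∀ σ : k ≃ₐ[K] k, mapCoeff σ.toRingEquiv f = f) (σ : k ≃ₐ[K] k) {P : OnePoint k}
    (hP : P ∈ fixedPts f) : multiplier f (σ • P) = σ (multiplier f P) :=
  multiplier_map hf (hK σ) hP

theorem normal_dynatomicField [Normal K k] (hf : degree f ≠ 0)
    (hK : ∀ σ : k ≃ₐ[K] k, mapCoeff σ.toRingEquiv f = f) : Normal K (dynatomicField K f) := by
  rw [IntermediateField.normal_iff_forall_map_le']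
  intro σ
  rw [dynatomicField, IntermediateField.adjoin_map]
  refine IntermediateField.adjoin.mono _ _ _ ?_
  rintro _ ⟨z, hz, rfl⟩
  exact galois_smul_mem_fixedPts hf hK σ hz

/-- The dynatomic Galois group is the image of any homomorphism from the absolute Galois group
whose kernel consists of the automorphisms fixing all fixed points. -/
theorem nonempty_dynatomicGal_mulEquiv_range [Normal K k] (hf : degree f ≠ 0)
    (hK : ∀ σ : k ≃ₐ[K] k, mapCoeff σ.toRingEquiv f = f) {G : Type*} [Group G]
    (ψ : (k ≃ₐ[K] k) →* G) (hψ : ∀ σ, ψ σ = 1 ↔ ∀ P ∈ fixedPts f, σ • P = P) :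
    Nonempty (DynatomicGal K f ≃* ψ.range) := by
  have := normal_dynatomicField hf hK
  have hker : (AlgEquiv.restrictNormalHom (K₁ := k) (dynatomicField K f)).ker = ψ.ker := by
    ext σ
    rw [IntermediateField.restrictNormalHom_ker, MonoidHom.mem_ker, hψ,
      IntermediateField.mem_fixingSubgroup_iff]
    constructor
    · intro h P hP
      induction P using OnePoint.rec with
      | infty => rfl
      | coe z =>
        rw [galois_smul_coe, h z (IntermediateField.subset_adjoin _ _ hP)]
    · intro h x hx
      induction hx using IntermediateField.adjoin_induction with
      | mem z hz => simpa using h z hz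
      | algebraMap a => simp
      | add x y _ _ hx hy => rw [map_add, hx, hy]
      | inv x _ hx => rw [map_inv₀, hx]
      | mul x y _ _ hx hy => rw [map_mul, hx, hy]
  have hsurj : Function.Surjective (AlgEquiv.restrictNormalHom (F := K) (K₁ := k)
      (dynatomicField K f)) := AlgEquiv.restrictNormalHom_surjective k
  exact ⟨(QuotientGroup.quotientKerEquivOfSurjective _ hsurj).symm.trans
    ((QuotientGroup.quotientMulEquivOfEq hker).trans (QuotientGroup.quotientKerEquivRange ψ))⟩

/-- The fixed points other than those in a rational set, as a set with Galois action. -/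
def fixedPtsAction (hf : degree f ≠ 0) (hK : ∀ σ : k ≃ₐ[K] k, mapCoeff σ.toRingEquiv f = f)
    (A : Set (OnePoint k)) (hA : ∀ Q ∈ A, ∀ σ : k ≃ₐ[K] k, σ • Q = Q) :
    SubMulAction (k ≃ₐ[K] k) (OnePoint k) where
  carrier := fixedPts f \ A
  smul_mem' σ P hP := ⟨galois_smul_mem_fixedPts hf hK σ hP.1, fun h => hP.2 (by
    have := hA _ h σ⁻¹
    rw [inv_smul_smul] at this
    rwa [this])⟩

theorem toPermHom_fixedPtsAction_eq_one_iff (hf : degree f ≠ 0)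
    (hK : ∀ σ : k ≃ₐ[K] k, mapCoeff σ.toRingEquiv f = f)
    (A : Set (OnePoint k)) (hA : ∀ Q ∈ A, ∀ σ : k ≃ₐ[K] k, σ • Q = Q) (σ : k ≃ₐ[K] k) :
    MulAction.toPermHom (k ≃ₐ[K] k) (fixedPtsAction hf hK A hA) σ = 1 ↔
      ∀ P ∈ fixedPts f, σ • P = P := by
  constructor
  · intro h P hP
    by_cases hPA : P ∈ A
    · exact hA P hPA σ
    · exact congrArg Subtype.val (DFunLike.congr_fun h ⟨P, hP, hPA⟩)
  · intro h
    ext P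
    exact h P.1 P.2.1

theorem card_dynatomicGal_le_two [Normal K k] (hf : degree f ≠ 0)
    (hK : ∀ σ : k ≃ₐ[K] k, mapCoeff σ.toRingEquiv f = f) (h2 : (fixedPts f).encard ≤ 2) :
    Nat.card (DynatomicGal K f) ≤ 2 := by
  obtain ⟨e⟩ := nonempty_dynatomicGal_mulEquiv_range hf hK _
    (toPermHom_fixedPtsAction_eq_one_iff hf hK ∅ (by simp))
  rw [Nat.card_congr e.toEquiv]
  have hfin : (fixedPts f \ ∅).Finite := by
    rw [Set.sdiff_empty]
    exact Set.finite_of_encard_le_coe (k := 2) (by exact_mod_cast h2)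
  have : Finite (fixedPtsAction hf hK ∅ (by simp)) := hfin
  refine (Nat.card_le_card_of_injective _ Subtype.val_injective).trans ?_
  rw [Nat.card_perm]
  have : Nat.card (fixedPtsAction hf hK ∅ (by simp)) ≤ 2 := by
    change Nat.card ↥(fixedPts f \ ∅) ≤ 2
    rw [Nat.card_coe_set_eq, Set.sdiff_empty]
    have : (fixedPts f).ncard ≤ (2 : ℕ) := by
      rw [← Nat.cast_le (α := ℕ∞), Set.Finite.cast_ncard_eq (by simpa using hfin)]
      exact_mod_cast h2
    exact this
  calc _ ≤ Nat.factorial 2 := Nat.factorial_le this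
    _ = 2 := rfl

/-- The dynatomic Galois group of a map with four fixed points, one of them rational, is
determined up to isomorphism by its order, which is governed by the number of rational
fixed points. -/
theorem dynatomicGal_trichotomy [Normal K k] (hf : degree f ≠ 0)
    (hK : ∀ σ : k ≃ₐ[K] k, mapCoeff σ.toRingEquiv f = f) (h4 : (fixedPts f).encard = 4)
    {Q : OnePoint k} (hQ : Q ∈ fixedPts f) (hQK : ∀ σ : k ≃ₐ[K] k, σ • Q = Q) :
    ({P ∈ fixedPts f | ∀ σ : k ≃ₐ[K] k, σ • P = P}.encard = 1 ∧
      (Nonempty (DynatomicGal K f ≃* Equiv.Perm (Fin 3)) ∨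
        Nonempty (DynatomicGal K f ≃* Multiplicative (ZMod 3)))) ∨
    ({P ∈ fixedPts f | ∀ σ : k ≃ₐ[K] k, σ • P = P}.encard = 2 ∧
      Nat.card (DynatomicGal K f) = 2) ∨
    ({P ∈ fixedPts f | ∀ σ : k ≃ₐ[K] k, σ • P = P}.encard = 4 ∧
      Nat.card (DynatomicGal K f) = 1) := by
  have hA : ∀ Q' ∈ ({Q} : Set (OnePoint k)), ∀ σ : k ≃ₐ[K] k, σ • Q' = Q' := by
    rintro _ rfl
    exact hQK
  set T := fixedPtsAction hf hK {Q} hA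
  have hT3 : (fixedPts f \ {Q}).encard = 3 := by
    rw [Set.encard_sdiff_singleton_of_mem hQ, h4]
    rfl
  have hcard : Nat.card T = 3 := by
    change Nat.card ↥(fixedPts f \ {Q}) = 3
    rw [Nat.card_coe_set_eq, Set.ncard, hT3]; rfl
  have : Finite T := Nat.finite_of_card_ne_zero (by omega)
  let e : T ≃ Fin 3 := Finite.equivFinOfCardEq hcard
  let ψ : (k ≃ₐ[K] k) →* Equiv.Perm (Fin 3) :=
    e.permCongrHom.toMonoidHom.comp (MulAction.toPermHom (k ≃ₐ[K] k) T)
  have hψ : ∀ σ, ψ σ = 1 ↔ ∀ P ∈ fixedPts f, σ • P = P := by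
    intro σ
    rw [← toPermHom_fixedPtsAction_eq_one_iff hf hK {Q} hA]
    exact MulEquiv.map_eq_one_iff e.permCongrHom
  have hψ_apply : ∀ σ i, ψ σ i = e (σ • e.symm i) := fun σ i => rfl
  obtain ⟨E⟩ := nonempty_dynatomicGal_mulEquiv_range hf hK ψ hψ
  have hN : {P ∈ fixedPts f | ∀ σ : k ≃ₐ[K] k, σ • P = P} =
      insert Q ((fun i => (e.symm i : OnePoint k)) '' {i : Fin 3 | ∀ h ∈ ψ.range, h i = i}) := by
    ext P
    simp only [Set.mem_ofPred_eq, Set.mem_insert_iff, Set.mem_image]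
    constructor
    · rintro ⟨hP, hPK⟩
      by_cases hPQ : P = Q
      · exact Or.inl hPQ
      · refine Or.inr ⟨e ⟨P, hP, hPQ⟩, ?_, by simp⟩
        rintro _ ⟨σ, rfl⟩
        rw [hψ_apply, Equiv.symm_apply_apply]
        congr 1
        exact Subtype.ext (hPK σ)
    · rintro (rfl | ⟨i, hi, rfl⟩)
      · exact ⟨hQ, hQK⟩
      · refine ⟨(e.symm i).2.1, fun σ => ?_⟩
        have := hi _ ⟨σ, rfl⟩
        rw [hψ_apply, ← Equiv.eq_symm_apply] at this
        exact congrArg Subtype.val this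
  have hNcard : {P ∈ fixedPts f | ∀ σ : k ≃ₐ[K] k, σ • P = P}.encard =
      {i : Fin 3 | ∀ h ∈ ψ.range, h i = i}.encard + 1 := by
    rw [hN, Set.encard_insert_of_notMem]
    · congr 1
      exact (Subtype.val_injective.comp e.symm.injective).encard_image _
    rintro ⟨i, -, hi⟩
    exact (e.symm i).2.2 hi
  have hGcard := Nat.card_congr E.toEquiv
  rw [hNcard]
  rcases subgroup_perm_fin_three ψ.range with ⟨h0, h3 | h6⟩ | ⟨h1, h2⟩ | ⟨h3, h1⟩
  · refine Or.inl ⟨by rw [h0]; rfl, Or.inr ⟨?_⟩⟩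
    have : Fact (Nat.Prime 3) := ⟨Nat.prime_three⟩
    exact mulEquivOfPrimeCardEq (p := 3) (hGcard.trans h3) (by simp)
  · refine Or.inl ⟨by rw [h0]; rfl, Or.inl ⟨E.trans ?_⟩⟩
    have : ψ.range = ⊤ := by
      apply Subgroup.eq_top_of_card_eq
      rw [h6, Nat.card_perm]
      simp [Nat.factorial]
    rw [this]
    exact Subgroup.topEquiv
  · exact Or.inr (Or.inl ⟨by rw [h1]; rfl, hGcard.trans h2⟩)
  · exact Or.inr (Or.inr ⟨by rw [h3]; rfl, hGcard.trans h1⟩)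

end GaloisAction
section Matched

variable {k : Type*} [Field k]

/-- The fixed points of `f` that become equal to their multiplier after conjugation by `ρ`. -/
def matchedBy (f : RatFunc k) (ρ : PGL(2, k)) : Set (OnePoint k) :=
  {P ∈ fixedPts f | ρ • ((multiplier f P : k) : OnePoint k) = P}

theorem matchedBy_subset (f : RatFunc k) (ρ : PGL(2, k)) : matchedBy f ρ ⊆ fixedPts f :=
  fun _ h => h.1

theorem injOn_multiplier_matchedBy (f : RatFunc k) (ρ : PGL(2, k)) :
    Set.InjOn (multiplier f) (matchedBy f ρ) := by
  intro P hP Q hQ h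
  rw [← hP.2, ← hQ.2, h]

theorem eq_of_subset_matchedBy {f : RatFunc k} {ρ τ : PGL(2, k)} {T : Set (OnePoint k)}
    (hT : 3 ≤ T.encard) (hρ : T ⊆ matchedBy f ρ) (hτ : T ⊆ matchedBy f τ) : ρ = τ := by
  obtain ⟨T', hT', h3⟩ := Set.exists_subset_encard_eq hT
  obtain ⟨P, Q, R, hPQ, hPR, hQR, rfl⟩ := Set.encard_eq_three.mp h3
  have hinj := (injOn_multiplier_matchedBy f ρ).mono (hT'.trans hρ)
  have hfix : ∀ A ∈ ({P, Q, R} : Set (OnePoint k)),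
      (τ⁻¹ * ρ) • ((multiplier f A : k) : OnePoint k) = ((multiplier f A : k) : OnePoint k) := by
    intro A hA
    rw [mul_smul, (hρ (hT' hA)).2, inv_smul_eq_iff, (hτ (hT' hA)).2]
  have hP : P ∈ ({P, Q, R} : Set (OnePoint k)) := by simp
  have hQ : Q ∈ ({P, Q, R} : Set (OnePoint k)) := by simp
  have hR : R ∈ ({P, Q, R} : Set (OnePoint k)) := by simp
  have := eq_one_of_smul_coe_eq (fun h => hPQ (hinj hP hQ h)) (fun h => hPR (hinj hP hR h))
    (fun h => hQR (hinj hQ hR h)) (hfix P hP) (hfix Q hQ) (hfix R hR)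
  exact (inv_mul_eq_one.mp this).symm

theorem exists_subset_matchedBy {f : RatFunc k} {T : Set (OnePoint k)} (hT : T.encard = 3)
    (hfix : T ⊆ fixedPts f) (hinj : Set.InjOn (multiplier f) T) : ∃ ρ, T ⊆ matchedBy f ρ := by
  obtain ⟨P, Q, R, hPQ, hPR, hQR, rfl⟩ := Set.encard_eq_three.mp hT
  have hne : ∀ A ∈ ({P, Q, R} : Set (OnePoint k)), ∀ B ∈ ({P, Q, R} : Set (OnePoint k)),
      A ≠ B → ((multiplier f A : k) : OnePoint k) ≠ ((multiplier f B : k) : OnePoint k) :=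
    fun A hA B hB h h' => h (hinj hA hB (OnePoint.coe_injective h'))
  obtain ⟨ρ, h1, h2, h3⟩ := exists_smul_eq_of_ne (hne P (by simp) Q (by simp) hPQ)
    (hne P (by simp) R (by simp) hPR) (hne Q (by simp) R (by simp) hQR) hPQ hPR hQR
  refine ⟨ρ, ?_⟩
  intro A hA
  refine ⟨hfix hA, ?_⟩
  rcases hA with rfl | rfl | rfl
  exacts [h1, h2, h3]

theorem encard_preimage_smul (ρ : PGL(2, k)) (s : Set (OnePoint k)) :
    ((ρ • ·) ⁻¹' s).encard = s.encard :=
  Set.encard_preimage_of_bijective (MulAction.bijective ρ) s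

variable [IsAlgClosed k] {f : RatFunc k}

theorem fixedPts_conj (hf : degree f ≠ 0) (ρ : PGL(2, k)) :
    fixedPts (conj f ρ) = (ρ • ·) ⁻¹' fixedPts f :=
  Set.ext fun P => mem_fixedPts_conj hf ρ P

theorem matchedPts_conj (hf : degree f ≠ 0) (ρ : PGL(2, k)) :
    matchedPts (conj f ρ) = (ρ • ·) ⁻¹' matchedBy f ρ := by
  ext P
  rw [matchedPts, Set.mem_ofPred_eq, mem_fixedPts_conj hf]
  change _ ↔ ρ • P ∈ fixedPts f ∧ _
  refine and_congr_right fun h => ?_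
  rw [multiplier_conj hf ρ h, smul_left_cancel_iff, eq_comm]

theorem isFPMForm_conj_iff (hf : degree f ≠ 0) (ρ : PGL(2, k)) :
    IsFPMForm (conj f ρ) ↔ 3 ≤ (fixedPts f).encard ∧ fixedPts f ⊆ matchedBy f ρ := by
  rw [IsFPMForm, fixedPts_conj hf, matchedPts_conj hf, encard_preimage_smul,
    Set.preimage_subset_preimage_iff]
  rw [(MulAction.surjective ρ).range_eq]
  exact Set.subset_univ _

theorem isPartialFPMForm_conj_iff (hf : degree f ≠ 0) (ρ : PGL(2, k)) :
    IsPartialFPMForm (conj f ρ) ↔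
      ((fixedPts f).encard ≤ 2 ∧ fixedPts f ⊆ matchedBy f ρ) ∨
      ((fixedPts f).encard = 4 ∧ 3 ≤ (matchedBy f ρ).encard) ∨
      (3 ≤ (fixedPts f).encard ∧ fixedPts f ⊆ matchedBy f ρ) := by
  rw [IsPartialFPMForm, isFPMForm_conj_iff hf, fixedPts_conj hf, matchedPts_conj hf,
    encard_preimage_smul, encard_preimage_smul, Set.preimage_subset_preimage_iff]
  rw [(MulAction.surjective ρ).range_eq]
  exact Set.subset_univ _

variable {K : Type*} [Field K] [Algebra K k]

theorem galois_smul_mem_matchedBy (hf : degree f ≠ 0)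
    (hK : ∀ σ : k ≃ₐ[K] k, mapCoeff σ.toRingEquiv f = f) (σ : k ≃ₐ[K] k) {ρ : PGL(2, k)}
    {P : OnePoint k} (hP : P ∈ matchedBy f ρ) :
    σ • P ∈ matchedBy f (mapPGL σ.toRingEquiv ρ) := by
  refine ⟨galois_smul_mem_fixedPts hf hK σ hP.1, ?_⟩
  rw [multiplier_galois_smul hf hK σ hP.1, ← galois_smul_coe, ← galois_smul_smul, hP.2]

theorem isDefinedOver_conj_iff [IsGalois K k] (hf : degree f ≠ 0)
    (hK : ∀ σ : k ≃ₐ[K] k, mapCoeff σ.toRingEquiv f = f) (haut : aut f = {1}) (ρ : PGL(2, k)) :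
    IsDefinedOver K (conj f ρ) ↔ ∀ σ : k ≃ₐ[K] k, mapPGL σ.toRingEquiv ρ = ρ := by
  rw [isDefinedOver_iff]
  refine forall_congr' fun σ => ?_
  rw [mapCoeff_conj hf, hK σ]
  refine ⟨fun h => ?_, fun h => by rw [h]⟩
  have : mapPGL σ.toRingEquiv ρ * ρ⁻¹ ∈ aut f := by
    rw [aut, Set.mem_ofPred_eq]
    rw [conj_mul hf, h, ← conj_mul hf, mul_inv_cancel, conj_one hf]
  rw [haut, Set.mem_singleton_iff, mul_inv_eq_one] at this
  exact this

end Matched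

section Counting

variable {K k : Type*} [Field K] [Field k] [Algebra K k] [IsAlgClosed k]
  {f : RatFunc k}

theorem encard_partialConjugators_of_isFPMForm (hf : degree f ≠ 0)
    (h : ∃ ρ ∈ partialConjugators K f, IsFPMForm (conj f ρ)) :
    (partialConjugators K f).encard = 1 := by
  obtain ⟨ρ, hρ, hfpm⟩ := h
  rw [isFPMForm_conj_iff hf] at hfpm
  rw [Set.encard_eq_one]
  refine ⟨ρ, Set.eq_singleton_iff_unique_mem.mpr ⟨hρ, fun τ hτ => ?_⟩⟩
  have h3 : 3 ≤ (matchedBy f τ).encard := by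
    rcases (isPartialFPMForm_conj_iff hf τ).mp hτ.1 with h | h | h
    · exact absurd (hfpm.1.trans h.1) (by decide)
    · exact h.2
    · exact h.1.trans (Set.encard_le_encard h.2)
  exact eq_of_subset_matchedBy h3 subset_rfl ((matchedBy_subset f τ).trans hfpm.2)

/-- The rational fixed points such that the other fixed points have distinct multipliers. -/
def freePts (K : Type*) {k : Type*} [Field K] [Field k] [Algebra K k] (f : RatFunc k) :
    Set (OnePoint k) :=
  {Q ∈ fixedPts f | (∀ σ : k ≃ₐ[K] k, σ • Q = Q) ∧ Set.InjOn (multiplier f) (fixedPts f \ {Q})}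

theorem encard_freePts_of_hasRepeatedMultiplier (hf : degree f ≠ 0)
    (hK : ∀ σ : k ≃ₐ[K] k, mapCoeff σ.toRingEquiv f = f) (hne : (freePts K f).Nonempty)
    (hrep : HasRepeatedMultiplier f) : (freePts K f).encard = 2 := by
  obtain ⟨Q, hQ, hQK, hinj⟩ := hne
  obtain ⟨P, hP, hPQ, hmul⟩ : ∃ P ∈ fixedPts f, P ≠ Q ∧ multiplier f P = multiplier f Q := by
    obtain ⟨A, hA, B, hB, hAB, h⟩ := hrep
    by_cases hAQ : A = Q
    · exact ⟨B, hB, fun h => hAB (hAQ.trans h.symm), by rw [← h, hAQ]⟩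
    · by_cases hBQ : B = Q
      · exact ⟨A, hA, hAQ, by rw [h, hBQ]⟩
      · exact absurd (hinj ⟨hA, hAQ⟩ ⟨hB, hBQ⟩ h) hAB
  rw [Set.encard_eq_two]
  refine ⟨P, Q, hPQ, Set.ext fun A => ⟨?_, ?_⟩⟩
  · rintro ⟨hA, -, hAinj⟩
    by_contra h
    simp only [Set.mem_insert_iff, Set.mem_singleton_iff, not_or] at h
    exact hPQ (hAinj ⟨hP, fun h' => h.1 h'.symm⟩ ⟨hQ, fun h' => h.2 h'.symm⟩ hmul)
  · rintro (rfl | rfl)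
    · refine ⟨hP, fun σ => ?_, fun B hB C hC hBC => ?_⟩
      · have hσ : σ • A ≠ Q := fun h => hPQ (by
          rw [← hQK σ] at h
          exact smul_left_cancel σ h)
        refine hinj ⟨galois_smul_mem_fixedPts hf hK σ hP, hσ⟩ ⟨hP, hPQ⟩ ?_
        rw [multiplier_galois_smul hf hK σ hP, hmul, ← multiplier_galois_smul hf hK σ hQ, hQK]
      · by_cases hBQ : B = Q <;> by_cases hCQ : C = Q
        · exact hBQ.trans hCQ.symm
        · exact absurd (hinj ⟨hC.1, hCQ⟩ ⟨hP, hPQ⟩ (by rw [← hBC, hBQ, hmul])) hC.2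
        · exact absurd (hinj ⟨hB.1, hBQ⟩ ⟨hP, hPQ⟩ (by rw [hBC, hCQ, hmul])) hB.2
        · exact hinj ⟨hB.1, hBQ⟩ ⟨hC.1, hCQ⟩ hBC
    · exact ⟨hQ, hQK, hinj⟩

variable [IsGalois K k]

theorem mem_partialConjugators_iff (hf : degree f ≠ 0)
    (hK : ∀ σ : k ≃ₐ[K] k, mapCoeff σ.toRingEquiv f = f) (haut : aut f = {1}) (ρ : PGL(2, k)) :
    ρ ∈ partialConjugators K f ↔
      IsPartialFPMForm (conj f ρ) ∧ ∀ σ : k ≃ₐ[K] k, mapPGL σ.toRingEquiv ρ = ρ := by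
  rw [← isDefinedOver_conj_iff hf hK haut]
  rfl

theorem infinite_partialConjugators_of_encard_le_two [Infinite K] (hf : degree f ≠ 0)
    (hK : ∀ σ : k ≃ₐ[K] k, mapCoeff σ.toRingEquiv f = f) (haut : aut f = {1})
    (h2 : (fixedPts f).encard ≤ 2) (hne : (partialConjugators K f).Nonempty) :
    (partialConjugators K f).Infinite := by
  obtain ⟨ρ, hρ⟩ := hne
  rw [mem_partialConjugators_iff hf hK haut, isPartialFPMForm_conj_iff hf] at hρ
  obtain ⟨hpart, hρK⟩ := hρ
  have hm : fixedPts f ⊆ matchedBy f ρ := by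
    rcases hpart with h | h | h
    · exact h.2
    · exact absurd (h.1 ▸ h2) (by decide)
    · exact h.2
  have hstab : ∀ z ∈ multiplier f '' fixedPts f, ∀ σ : k ≃ₐ[K] k,
      σ z ∈ multiplier f '' fixedPts f := by
    rintro _ ⟨P, hP, rfl⟩ σ
    exact ⟨σ • P, galois_smul_mem_fixedPts hf hK σ hP, multiplier_galois_smul hf hK σ hP⟩
  obtain ⟨a, b, hsub, hsum, hprod⟩ : ∃ a b : k, multiplier f '' fixedPts f ⊆ {a, b} ∧
      (∀ σ : k ≃ₐ[K] k, σ (a + b) = a + b) ∧ (∀ σ : k ≃ₐ[K] k, σ (a * b) = a * b) := by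
    have hle : (multiplier f '' fixedPts f).encard ≤ 2 := (Set.encard_image_le _ _).trans h2
    set Z := multiplier f '' fixedPts f
    rcases hle.lt_or_eq with h | h
    · have h1 : Z.encard ≤ 1 := Order.le_of_lt_add_one (by simpa [one_add_one_eq_two] using h)
      rcases Set.encard_le_one_iff_eq.mp h1 with h | ⟨x, h⟩
      · exact ⟨0, 0, by simp [h], by simp, by simp⟩
      · have hx : ∀ σ : k ≃ₐ[K] k, σ x = x := fun σ => by
          have := hstab x (by simp [h]) σ
          rwa [h] at this
        exact ⟨x, x, by simp [h], fun σ => by simp [hx], fun σ => by simp [hx]⟩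
    · obtain ⟨x, y, hxy, h⟩ := Set.encard_eq_two.mp h
      have hσ : ∀ σ : k ≃ₐ[K] k, (σ x = x ∧ σ y = y) ∨ (σ x = y ∧ σ y = x) := by
        intro σ
        have hx := hstab x (by simp [h]) σ
        have hy := hstab y (by simp [h]) σ
        have hne : σ x ≠ σ y := fun h => hxy (σ.injective h)
        rw [h] at hx hy
        rcases hx with hx | hx <;> rcases hy with hy | hy
        · exact absurd (hx.trans hy.symm) hne
        · exact Or.inl ⟨hx, hy⟩
        · exact Or.inr ⟨hx, hy⟩
        · exact absurd (Eq.trans hx (Eq.symm hy)) hne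
      refine ⟨x, y, h.le, fun σ => ?_, fun σ => ?_⟩
      · rcases hσ σ with ⟨h1, h2⟩ | ⟨h1, h2⟩ <;> simp [h1, h2, add_comm]
      · rcases hσ σ with ⟨h1, h2⟩ | ⟨h1, h2⟩ <;> simp [h1, h2, mul_comm]
  obtain ⟨s, hs⟩ := (InfiniteGalois.mem_range_algebraMap_iff_fixed _).mpr hsum
  obtain ⟨p, hp⟩ := (InfiniteGalois.mem_range_algebraMap_iff_fixed _).mpr hprod
  have hdet_eq : ∀ t : K, (!![t, -p; 1, t - s] : Matrix (Fin 2) (Fin 2) K).det =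
      t ^ 2 - s * t + p := by
    intro t
    rw [Matrix.det_fin_two_of]
    ring
  have hinf : {t : K | t ^ 2 - s * t + p ≠ 0}.Infinite := by
    have hfin : {t : K | t ^ 2 - s * t + p = 0}.Finite := by
      have hq : (Polynomial.X ^ 2 - Polynomial.C s * Polynomial.X + Polynomial.C p : K[X]) ≠ 0 := by
        intro h0
        have := congrArg (fun q => Polynomial.coeff q 2) h0
        simp at this
      refine (Polynomial.finite_setOfPred_isRoot hq).subset fun t ht => ?_
      simpa [Polynomial.IsRoot] using ht
    exact hfin.infinite_compl
  have hdet : ∀ t : K, t ^ 2 - s * t + p ≠ 0 →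
      (!![t, -p; 1, t - s] : Matrix (Fin 2) (Fin 2) K).det ≠ 0 := fun t ht => by rwa [hdet_eq]
  let g : {t : K | t ^ 2 - s * t + p ≠ 0} → GL (Fin 2) k := fun t =>
    Matrix.GeneralLinearGroup.map (algebraMap K k)
      (Matrix.GeneralLinearGroup.mkOfDetNeZero _ (hdet t.1 t.2))
  have hg : ∀ t, (g t).val = !![algebraMap K k t, -(a * b); 1, algebraMap K k t - (a + b)] := by
    intro t
    rw [← hs, ← hp]
    ext i j
    fin_cases i <;> fin_cases j <;> simp [g, Matrix.GeneralLinearGroup.mkOfDetNeZero]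
  have hgfix : ∀ t, ∀ z ∈ multiplier f '' fixedPts f,
      (Matrix.ProjGenLinGroup.mk (g t) : PGL(2, k)) • (z : OnePoint k) = z := by
    intro t z hz
    have hv : (![z, 1] : Fin 2 → k) ≠ 0 := fun h => by simpa using congr_fun h 1
    rw [← pt_coe, mk_smul_pt _ hv, pt_eq_pt_iff (mulVec_ne_zero _ hv) hv, hg]
    rcases hsub hz with rfl | rfl
    · simp; ring
    · simp; ring
  have hmem : ∀ t, ρ * Matrix.ProjGenLinGroup.mk (g t) ∈ partialConjugators K f := by
    intro t
    rw [mem_partialConjugators_iff hf hK haut, isPartialFPMForm_conj_iff hf]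
    refine ⟨Or.inl ⟨h2, fun P hP => ⟨hP, ?_⟩⟩, fun σ => ?_⟩
    · rw [mul_smul, hgfix t _ ⟨P, hP, rfl⟩, (hm hP).2]
    · rw [map_mul, hρK, mul_right_inj]
      exact (isDefinedOverPGL_iff _).mp ⟨Matrix.ProjGenLinGroup.mk _, rfl⟩ σ
  have := hinf.to_subtype
  refine Set.infinite_of_injective_forall_mem (f := fun t => ρ * Matrix.ProjGenLinGroup.mk (g t))
    (fun t t' h => ?_) hmem
  obtain ⟨u, hu⟩ := Matrix.ProjGenLinGroup.mk_eq_mk_iff.mp (mul_left_cancel h)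
  have h1 := congrArg (fun m : GL (Fin 2) k => m.val 1 0) hu
  have h2 := congrArg (fun m : GL (Fin 2) k => m.val 0 0) hu
  simp [hg] at h1 h2
  rw [h1, Units.val_one, mul_one] at h2
  exact Subtype.ext ((algebraMap K k).injective h2)

theorem encard_partialConjugators_eq (hf : degree f ≠ 0)
    (hK : ∀ σ : k ≃ₐ[K] k, mapCoeff σ.toRingEquiv f = f) (haut : aut f = {1})
    (h4 : (fixedPts f).encard = 4)
    (hfpm : ¬ ∃ ρ ∈ partialConjugators K f, IsFPMForm (conj f ρ)) :
    (partialConjugators K f).encard = (freePts K f).encard := by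
  have h34 : 3 ≤ (fixedPts f).encard := by rw [h4]; decide
  have hthree : ∀ Q ∈ fixedPts f, (fixedPts f \ {Q}).encard = 3 := fun Q hQ => by
    rw [Set.encard_sdiff_singleton_of_mem hQ, h4]
    rfl
  have hnot : ∀ ρ ∈ partialConjugators K f, ¬ fixedPts f ⊆ matchedBy f ρ := fun ρ hρ hs =>
    hfpm ⟨ρ, hρ, (isFPMForm_conj_iff hf ρ).mpr ⟨h34, hs⟩⟩
  have h3 : ∀ ρ ∈ partialConjugators K f, 3 ≤ (matchedBy f ρ).encard := by
    intro ρ hρ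
    rcases (isPartialFPMForm_conj_iff hf ρ).mp hρ.1 with h | h | h
    · exact absurd (h34.trans h.1) (by decide)
    · exact h.2
    · exact absurd h.2 (hnot ρ hρ)
  have hmiss : ∀ ρ ∈ partialConjugators K f, ∃ Q ∈ fixedPts f, matchedBy f ρ = fixedPts f \ {Q} := by
    intro ρ hρ
    obtain ⟨Q, hQ, hQm⟩ := Set.not_subset.mp (hnot ρ hρ)
    have hsub : matchedBy f ρ ⊆ fixedPts f \ {Q} := fun P hP => ⟨hP.1, fun h => hQm (h ▸ hP)⟩
    refine ⟨Q, hQ, Set.Finite.eq_of_subset_of_encard_le ?_ hsub ?_⟩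
    · exact (Set.finite_of_encard_eq_coe (k := 3) (hthree Q hQ)).subset hsub
    · rw [hthree Q hQ]; exact h3 ρ hρ
  have hex : ∀ Q ∈ freePts K f, ∃ ρ ∈ partialConjugators K f,
      matchedBy f ρ = fixedPts f \ {Q} := by
    rintro Q ⟨hQ, hQK, hinj⟩
    obtain ⟨ρ, hρ⟩ := exists_subset_matchedBy (hthree Q hQ) Set.sdiff_subset hinj
    have hmem : ρ ∈ partialConjugators K f := by
      rw [mem_partialConjugators_iff hf hK haut, isPartialFPMForm_conj_iff hf]
      refine ⟨Or.inr (Or.inl ⟨h4, ?_⟩), fun σ => ?_⟩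
      · rw [← hthree Q hQ]
        exact Set.encard_le_encard hρ
      · refine (eq_of_subset_matchedBy (hthree Q hQ).ge hρ fun P hP => ?_).symm
        have hP' : σ⁻¹ • P ∈ fixedPts f \ {Q} :=
          ⟨galois_smul_mem_fixedPts hf hK _ hP.1, fun h => hP.2 (by
            rw [Set.mem_singleton_iff, inv_smul_eq_iff, hQK] at h
            exact h)⟩
        have := galois_smul_mem_matchedBy hf hK σ (hρ hP')
        rwa [smul_inv_smul] at this
    obtain ⟨Q', hQ', hQm⟩ := hmiss ρ hmem
    refine ⟨ρ, hmem, ?_⟩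
    have : Q' = Q := by
      by_contra hne
      exact (hQm ▸ hρ ⟨hQ', hne⟩ : Q' ∈ fixedPts f \ {Q'}).2 rfl
    rw [hQm, this]
  choose! F hFmem hF using hex
  have himage : F '' freePts K f = partialConjugators K f := by
    ext ρ
    constructor
    · rintro ⟨Q, hQ, rfl⟩
      exact hFmem Q hQ
    · intro hρ
      obtain ⟨Q, hQ, hQm⟩ := hmiss ρ hρ
      have hfree : Q ∈ freePts K f := by
        refine ⟨hQ, fun σ => ?_, hQm ▸ injOn_multiplier_matchedBy f ρ⟩
        by_contra hne
        have h1 : σ • Q ∈ matchedBy f ρ := by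
          rw [hQm]
          exact ⟨galois_smul_mem_fixedPts hf hK σ hQ, hne⟩
        have h2 := galois_smul_mem_matchedBy hf hK σ⁻¹ h1
        rw [inv_smul_smul, ((mem_partialConjugators_iff hf hK haut ρ).mp hρ).2, hQm] at h2
        exact h2.2 rfl
      refine ⟨Q, hfree, eq_of_subset_matchedBy (f := f) (hthree Q hQ).ge ?_ ?_⟩
      · rw [hF Q hfree]
      · rw [hQm]
  rw [← himage]
  refine Set.InjOn.encard_image fun Q hQ Q' hQ' h => ?_
  by_contra hne
  have h1 : Q ∈ matchedBy f (F Q) := by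
    rw [h, hF Q' hQ']
    exact ⟨hQ.1, hne⟩
  rw [hF Q hQ] at h1
  exact h1.2 rfl

end Counting
section Counting

variable {K k : Type*} [Field K] [Field k] [Algebra K k] {f : RatFunc k}

theorem not_dynatomicGal_mulEquiv_of_card_le_two (h : Nat.card (DynatomicGal K f) ≤ 2) :
    ¬ (Nonempty (DynatomicGal K f ≃* Equiv.Perm (Fin 3)) ∨
      Nonempty (DynatomicGal K f ≃* Multiplicative (ZMod 3))) := by
  rintro (⟨⟨e⟩⟩ | ⟨⟨e⟩⟩)
  · rw [Nat.card_congr e.toEquiv, Nat.card_perm] at h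
    simp [Nat.factorial] at h
  · rw [Nat.card_congr e.toEquiv] at h
    simp at h

theorem freePts_eq_of_not_hasRepeatedMultiplier (h : ¬ HasRepeatedMultiplier f) :
    freePts K f = {P ∈ fixedPts f | ∀ σ : k ≃ₐ[K] k, σ • P = P} := by
  ext P
  refine ⟨fun hP => ⟨hP.1, hP.2.1⟩, fun hP => ⟨hP.1, hP.2, fun A hA B hB hAB => ?_⟩⟩
  by_contra hne
  exact h ⟨A, hA.1, B, hB.1, hne, hAB⟩

variable [IsAlgClosed k] [IsGalois K k]

theorem encard_partialConjugators_trichotomy (hf : degree f ≠ 0)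
    (hK : ∀ σ : k ≃ₐ[K] k, mapCoeff σ.toRingEquiv f = f) (haut : aut f = {1})
    (h4 : (fixedPts f).encard = 4) (hne : (partialConjugators K f).Nonempty)
    (hfpm : ¬ ∃ ρ ∈ partialConjugators K f, IsFPMForm (conj f ρ)) :
    ((partialConjugators K f).encard = 1 ∧ ¬ HasRepeatedMultiplier f ∧
      (Nonempty (DynatomicGal K f ≃* Equiv.Perm (Fin 3)) ∨
        Nonempty (DynatomicGal K f ≃* Multiplicative (ZMod 3)))) ∨
    ((partialConjugators K f).encard = 2 ∧ HasRepeatedMultiplier f ∧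
      Nat.card (DynatomicGal K f) ≤ 2) ∨
    ((partialConjugators K f).encard = 2 ∧ ¬ HasRepeatedMultiplier f ∧
      Nat.card (DynatomicGal K f) = 2) ∨
    ((partialConjugators K f).encard = 4 ∧ ¬ HasRepeatedMultiplier f ∧
      Nat.card (DynatomicGal K f) = 1) := by
  have hcard := encard_partialConjugators_eq hf hK haut h4 hfpm
  have hfree : (freePts K f).Nonempty := by
    rw [← Set.encard_pos, ← hcard, Set.encard_pos]
    exact hne
  obtain ⟨Q, hQ⟩ := hfree
  have htri := dynatomicGal_trichotomy hf hK h4 hQ.1 hQ.2.1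
  by_cases hrep : HasRepeatedMultiplier f
  · have h2 := encard_freePts_of_hasRepeatedMultiplier hf hK ⟨Q, hQ⟩ hrep
    refine Or.inr (Or.inl ⟨hcard.trans h2, hrep, ?_⟩)
    have hsub : freePts K f ⊆ {P ∈ fixedPts f | ∀ σ : k ≃ₐ[K] k, σ • P = P} :=
      fun P hP => ⟨hP.1, hP.2.1⟩
    have hle := Set.encard_le_encard hsub
    rw [h2] at hle
    rcases htri with h | h | h
    · exact absurd (hle.trans h.1.le) (by decide)
    · exact h.2.le
    · exact h.2.le.trans (by norm_num)
  · rw [freePts_eq_of_not_hasRepeatedMultiplier hrep] at hcard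
    rw [hcard]
    rcases htri with h | h | h
    · exact Or.inl ⟨h.1, hrep, h.2⟩
    · exact Or.inr (Or.inr (Or.inl ⟨h.1, hrep, h.2⟩))
    · exact Or.inr (Or.inr (Or.inr ⟨h.1, hrep, h.2⟩))

end Counting
end RatDyn

theorem mainTheorem7 {K Kbar : Type*} [Field K] [PerfectField K] [Infinite K]
    [Field Kbar] [Algebra K Kbar] [IsAlgClosure K Kbar]
    (f : RatFunc Kbar) (hfK : RatDyn.IsDefinedOver K f) (hdeg : RatDyn.degree f = 3)
    (haut : RatDyn.aut f = {1}) :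
    (∀ ρ : PGL(2, Kbar), RatDyn.IsPartialFPMForm (RatDyn.conj f ρ) →
      (RatDyn.IsDefinedOver K (RatDyn.conj f ρ) ↔ RatDyn.IsDefinedOverPGL K ρ)) ∧
    ((RatDyn.partialConjugators K f).Nonempty →
      ((RatDyn.partialConjugators K f).encard = 1 ↔
        (∃ ρ ∈ RatDyn.partialConjugators K f, RatDyn.IsFPMForm (RatDyn.conj f ρ)) ∨
        Nonempty (RatDyn.DynatomicGal K f ≃* Equiv.Perm (Fin 3)) ∨
        Nonempty (RatDyn.DynatomicGal K f ≃* Multiplicative (ZMod 3))) ∧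
      ((RatDyn.partialConjugators K f).encard = 2 ↔
        (¬ ∃ ρ ∈ RatDyn.partialConjugators K f, RatDyn.IsFPMForm (RatDyn.conj f ρ)) ∧
        (RatDyn.fixedPts f).encard = 4 ∧
        (Nat.card (RatDyn.DynatomicGal K f) = 2 ∨ RatDyn.HasRepeatedMultiplier f)) ∧
      ((RatDyn.partialConjugators K f).encard = 4 ↔
        (¬ ∃ ρ ∈ RatDyn.partialConjugators K f, RatDyn.IsFPMForm (RatDyn.conj f ρ)) ∧
        ¬ RatDyn.HasRepeatedMultiplier f ∧
        (RatDyn.fixedPts f).encard = 4 ∧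
        Subsingleton (RatDyn.DynatomicGal K f)) ∧
      (3 ≤ (RatDyn.fixedPts f).encard →
        (RatDyn.partialConjugators K f).encard = 1 ∨
        (RatDyn.partialConjugators K f).encard = 2 ∨
        (RatDyn.partialConjugators K f).encard = 4)) := by
  have : IsAlgClosed Kbar := IsAlgClosure.isAlgClosed K
  have : Normal K Kbar := IsAlgClosure.normal K Kbar
  have : Algebra.IsAlgebraic K Kbar := IsAlgClosure.isAlgebraic
  have : Algebra.IsSeparable K Kbar := Algebra.IsAlgebraic.isSeparable_of_perfectField
  have : IsGalois K Kbar := {}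
  have hf : RatDyn.degree f ≠ 0 := by omega
  have hK := (RatDyn.isDefinedOver_iff f).mp hfK
  refine ⟨fun ρ _ => by
    rw [RatDyn.isDefinedOver_conj_iff hf hK haut, RatDyn.isDefinedOverPGL_iff], fun hne => ?_⟩
  have hsub : Subsingleton (RatDyn.DynatomicGal K f) ↔
      Nat.card (RatDyn.DynatomicGal K f) = 1 := by
    rw [Nat.card_eq_one_iff_unique]
    exact ⟨fun h => ⟨h, ⟨1⟩⟩, fun h => h.1⟩
  have hgal := RatDyn.not_dynatomicGal_mulEquiv_of_card_le_two (K := K) (f := f)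
  rw [hsub]
  by_cases hfpm : ∃ ρ ∈ RatDyn.partialConjugators K f, RatDyn.IsFPMForm (RatDyn.conj f ρ)
  · have h1 := RatDyn.encard_partialConjugators_of_isFPMForm hf hfpm
    have h12 : ¬ ((1 : ℕ∞) = 2) := by decide
    have h14 : ¬ ((1 : ℕ∞) = 4) := by decide
    simp [h1, hfpm, h12, h14]
  · have hcases : (RatDyn.fixedPts f).encard ≤ 2 ∨ (RatDyn.fixedPts f).encard = 4 := by
      obtain ⟨ρ, hρ⟩ := hne
      rcases (RatDyn.isPartialFPMForm_conj_iff hf ρ).mp hρ.1 with h | h | h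
      · exact Or.inl h.1
      · exact Or.inr h.1
      · exact absurd ⟨ρ, hρ, (RatDyn.isFPMForm_conj_iff hf ρ).mpr h⟩ hfpm
    rcases hcases with h2 | h4
    · have htop := (RatDyn.infinite_partialConjugators_of_encard_le_two hf hK haut h2 hne).encard_eq
      have hcard := RatDyn.card_dynatomicGal_le_two hf hK h2
      have h4 : (RatDyn.fixedPts f).encard ≠ 4 := fun h => absurd (h ▸ h2) (by decide)
      have h3 : ¬ 3 ≤ (RatDyn.fixedPts f).encard := fun h => absurd (h.trans h2) (by decide)
      have t1 : ¬ ((⊤ : ℕ∞) = 1) := by decide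
      have t2 : ¬ ((⊤ : ℕ∞) = 2) := by decide
      have t4 : ¬ ((⊤ : ℕ∞) = 4) := by decide
      rw [htop]
      exact ⟨⟨fun h => absurd h t1, fun h => absurd h (not_or.mpr ⟨hfpm, hgal hcard⟩)⟩,
        ⟨fun h => absurd h t2, fun h => absurd h.2.1 h4⟩,
        ⟨fun h => absurd h t4, fun h => absurd h.2.2.1 h4⟩, fun h => absurd h h3⟩
    · have h21 : ¬ ((2 : ℕ∞) = 1) := by decide
      have h24 : ¬ ((2 : ℕ∞) = 4) := by decide
      have h12 : ¬ ((1 : ℕ∞) = 2) := by decide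
      have h14 : ¬ ((1 : ℕ∞) = 4) := by decide
      have h41 : ¬ ((4 : ℕ∞) = 1) := by decide
      have h42 : ¬ ((4 : ℕ∞) = 2) := by decide
      rcases RatDyn.encard_partialConjugators_trichotomy hf hK haut h4 hne hfpm with
        ⟨h, hr, hG⟩ | ⟨h, hr, hG⟩ | ⟨h, hr, hG⟩ | ⟨h, hr, hG⟩ <;> rw [h]
      · exact ⟨⟨fun _ => Or.inr hG, fun _ => rfl⟩,
          ⟨fun h => absurd h h12, fun h' => h'.2.2.elim (fun h' => absurd hG (hgal h'.le))
            fun h' => absurd h' hr⟩,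
          ⟨fun h => absurd h h14, fun h' => absurd hG (hgal (h'.2.2.2.le.trans one_le_two))⟩,
          fun _ => Or.inl rfl⟩
      · exact ⟨⟨fun h => absurd h h21, fun h => absurd h (not_or.mpr ⟨hfpm, hgal hG⟩)⟩,
          ⟨fun _ => ⟨hfpm, h4, Or.inr hr⟩, fun _ => rfl⟩,
          ⟨fun h => absurd h h24, fun h' => absurd hr h'.2.1⟩, fun _ => Or.inr (Or.inl rfl)⟩
      · exact ⟨⟨fun h => absurd h h21, fun h => absurd h (not_or.mpr ⟨hfpm, hgal hG.le⟩)⟩,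
          ⟨fun _ => ⟨hfpm, h4, Or.inl hG⟩, fun _ => rfl⟩,
          ⟨fun h => absurd h h24, fun h' => absurd (hG.symm.trans h'.2.2.2) (by decide)⟩,
          fun _ => Or.inr (Or.inl rfl)⟩
      · exact ⟨⟨fun h => absurd h h41,
            fun h => absurd h (not_or.mpr ⟨hfpm, hgal (hG.le.trans one_le_two)⟩)⟩,
          ⟨fun h => absurd h h42, fun h' => h'.2.2.elim
            (fun h' => absurd (hG.symm.trans h') (by decide)) fun h' => absurd h' hr⟩,
          ⟨fun _ => ⟨hfpm, hr, h4, hG⟩, fun _ => rfl⟩, fun _ => Or.inr (Or.inr rfl)⟩
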